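/- Let $\mathcal{M}=(S,\mathit{Act},P,s_{\mathit{init}},\mathit{rew})$ be a finite Markov decision process: $S$ and $\mathit{Act}$ are finite, $P:S\times \mathit{Act}\times S\to[0,1]\cap\mathbb{Q}$ with $\sum_{t}P(s,\alpha,t)\in\{0,1\}$ for all $(s,\alpha)$, and $\mathit{rew}:S\times \mathit{Act}\to\mathbb{N}$. An action $\alpha$ is enabled in $s$, written $\alpha\in\mathit{Act}(s)$, if $P(s,\alpha,\cdot)\neq 0$, and $s$ is a trap if no action is enabled in $s$. A finite path is a sequence $s_0\,\alpha_0\,s_1\ldots\alpha_{k-1}\,s_k$ with $P(s_i,\alpha_i,s_{i+1})>0$ for all $i<k$; its reward is $\sum_{i<k}\mathit{rew}(s_i,\alpha_i)$. A maximal path is an infinite path or a finite path that ends in a trap. A scheduler $\mathfrak{S}$ assigns to each finite path whose last state $s$ is not a trap a probability distribution on $\mathit{Act}(s)$; it is memoryless if this distribution depends only on the last state, and deterministic if all these distributions are Dirac. $\Pr^{\mathfrak{S}}_{s}$ denotes the induced probability measure on maximal paths from $s$. An $\mathfrak{S}$-path is a path all of whose actions are chosen by $\mathfrak{S}$ with positive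 probability after the respective prefix. An end component is a pair $(E,\mathfrak{A})$ of a nonempty set $E\subseteq S$ and nonempty sets $\mathfrak{A}(s)\subseteq\mathit{Act}(s)$, $s\in E$, whose transitions do not leave $E$ and whose induced graph on $E$ is strongly connected. Let $\mathit{goal},\mathit{fail}\in S$, where $\mathit{goal}$ is a trap, and assume (A1) for every state $s$: $\mathit{goal}$ is not reachable from $s$ if and only if $s=\mathit{fail}$; (A2) $\mathcal{M}$ has no end component. For a scheduler $\mathfrak{S}$ with $\Pr^{\mathfrak{S}}_{s_{\mathit{init}}}(\Diamond\mathit{goal})>0$ let $\mathbb{CE}^{\mathfrak{S}}\in[0,\infty]$ be the expectation, with respect to the conditional measure $\Pr^{\mathfrak{S}}_{s_{\mathit{init}}}(\,\cdot\mid\Diamond\mathit{goal})$, of the reward accumulated until $\mathit{goal}$ is first reached, and let $\mathbb{CE}^{\max}=\sup_{\mathfrak{S}}\mathbb{CE}^{\mathfrak{S}}$, where $\mathfrak{S}$ ranges over all schedulers with $\Pr^{\mathfrak{S}}_{s_{\mathit{init}}}(\Diamond\mathit{goal})>0$ and $\Pr^{\mathfrak{S}}_{s_{\mathit{init}}}(\Diamond(\mathit{goal}\vee\mathit{fail}))=1$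 (and $\sup\varnothing=-\infty$). A scheduler $\mathfrak{U}$ is called critical if $\Pr^{\mathfrak{U}}_{s_{\mathit{init}}}(\Box\neg\mathit{goal})=1$ and there is a finite $\mathfrak{U}$-path $s_0\,\alpha_0\,s_1\ldots\alpha_{m-1}\,s_m$ with $s_0=s_{\mathit{init}}$ such that, for some $k<m$, $s_k=s_m$ and $\mathit{rew}(s_i,\alpha_i)>0$ for some $k\le i<m$. Then the following three statements are equivalent: (i) $\mathbb{CE}^{\max}=\infty$; (ii) $\mathcal{M}$ has a memoryless deterministic critical scheduler; (iii) $\mathcal{M}$ has a critical scheduler. -/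

import Mathlib

open MeasureTheory ProbabilityTheory
open scoped ENNReal NNReal

noncomputable section

/-- A finite Markov decision process with state space `S` and action set `A`, rational transition
probabilities and natural-number rewards; every row `P s a ·` sums to `0` or `1`. -/
structure MDP (S A : Type*) [Fintype S] [Fintype A] where
  /-- transition probabilities -/
  P : S → A → S → ℚ≥0
  sum_P : ∀ s a, ∑ t, P s a t = 0 ∨ ∑ t, P s a t = 1
  /-- initial state -/
  init : S
  /-- reward function -/
  rew : S → A → ℕ

namespace MDP

/-- Last state of the alternating sequence that starts in `s` and continues with the listed pairs
(action, successor state), the most recent pair being the head of the list. -/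
def lastOf {S A : Type*} (s : S) : List (A × S) → S
  | [] => s
  | (_, t) :: _ => t

/-- The list of state-action pairs `(sᵢ, αᵢ)` along the sequence, the most recent one first. -/
def pairsOf {S A : Type*} (s : S) : List (A × S) → List (S × A)
  | [] => []
  | (a, _) :: l => (lastOf s l, a) :: pairsOf s l

theorem lastOf_append {S A : Type*} (s : S) (l l' : List (A × S)) :
    lastOf s (l' ++ l) = lastOf (lastOf s l) l' := by
  cases l' <;> rfl

variable {S A : Type*} [Fintype S] [Fintype A] (M : MDP S A)

/-- The set `Act(s)` of actions enabled in `s`. -/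
def act (s : S) : Set A := {a | M.P s a ≠ 0}

/-- A trap is a state without enabled actions. -/
def IsTrap (s : S) : Prop := M.act s = ∅

/-- All transitions of the sequence have positive probability. -/
def IsValid (s : S) : List (A × S) → Prop
  | [] => True
  | (a, t) :: l => IsValid s l ∧ 0 < M.P (lastOf s l) a t

/-- Finite paths `s₀ α₀ s₁ α₁ … sₖ`, stored as the first state `s₀` together with the list
`[(αₖ₋₁, sₖ), …, (α₀, s₁)]` (most recent step first). -/
structure FinPath where
  first : S
  steps : List (A × S)
  valid : M.IsValid first steps

variable {M}

namespace FinPath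

/-- The last state of a finite path. -/
def last (π : M.FinPath) : S := lastOf π.first π.steps

/-- The state-action pairs `(sᵢ, αᵢ)` occurring along a finite path. -/
def pairs (π : M.FinPath) : List (S × A) := pairsOf π.first π.steps

/-- The accumulated reward of a finite path. -/
def rew (π : M.FinPath) : ℕ := (π.pairs.map fun p => M.rew p.1 p.2).sum

/-- The path of length `0` at `s`. -/
def nil (s : S) : M.FinPath := ⟨s, [], trivial⟩

/-- Extension of a path by one transition. -/
def snoc (π : M.FinPath) (a : A) (t : S) (h : 0 < M.P π.last a t) : M.FinPath :=
  ⟨π.first, (a, t) :: π.steps, π.valid, h⟩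

end FinPath

theorem isValid_append {s : S} {l l' : List (A × S)} (h : M.IsValid s l)
    (h' : M.IsValid (lastOf s l) l') : M.IsValid s (l' ++ l) := by
  induction l' with
  | nil => exact h
  | cons p l' ih =>
    refine ⟨ih h'.1, ?_⟩
    show 0 < M.P (lastOf s (l' ++ l)) p.1 p.2
    rw [lastOf_append]
    exact h'.2

namespace FinPath

/-- Concatenation `π; ξ` of two paths where `ξ` starts in the last state of `π`. -/
def append (π ξ : M.FinPath) (h : ξ.first = π.last) : M.FinPath :=
  ⟨π.first, ξ.steps ++ π.steps, isValid_append π.valid (by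
    have h' := ξ.valid
    rw [h] at h'
    exact h')⟩

/-- A cyclic path: positive length, and the first state equals the last one. -/
def IsCycle (ξ : M.FinPath) : Prop := ξ.steps ≠ [] ∧ ξ.last = ξ.first

/-- Some state-action pair along the path has a positive reward. -/
def IsPositive (ξ : M.FinPath) : Prop := ∃ p ∈ ξ.pairs, 0 < M.rew p.1 p.2

end FinPath

variable (M)

/-- `t` is reachable from `s`, i.e. `s ⊨ ∃◇t`. -/
def CanReach (s t : S) : Prop := ∃ π : M.FinPath, π.first = s ∧ π.last = t

/-- End components `(E, 𝔄)`: a nonempty set `E` of states and nonempty sets `𝔄 s ⊆ Act(s)` for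
`s ∈ E` that form a sub-MDP (transitions do not leave `E`) whose induced graph is strongly
connected. -/
structure IsEndComponent (E : Set S) (𝔄 : S → Set A) : Prop where
  nonempty : E.Nonempty
  act_nonempty : ∀ s ∈ E, (𝔄 s).Nonempty
  act_subset : ∀ s ∈ E, 𝔄 s ⊆ M.act s
  closed : ∀ s ∈ E, ∀ a ∈ 𝔄 s, ∀ t, 0 < M.P s a t → t ∈ E
  connected : ∀ s ∈ E, ∀ t ∈ E,
    Relation.ReflTransGen (fun u v => u ∈ E ∧ ∃ a ∈ 𝔄 u, 0 < M.P u a v) s t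

/-- The MDP has no end component. -/
def NoEndComponent : Prop := ∀ (E : Set S) (𝔄 : S → Set A), ¬ M.IsEndComponent E 𝔄

/-- A (randomized, history-dependent) scheduler assigns to each finite path whose last state `s`
is not a trap a probability distribution over `Act(s)`. -/
structure Scheduler where
  dist : (π : M.FinPath) → ¬ M.IsTrap π.last → PMF A
  support_subset : ∀ π h, (dist π h).support ⊆ M.act π.last

variable {M}

theorem sum_P_eq_one {s : S} {a : A} (h : a ∈ M.act s) :
    ∑ t, (((M.P s a t : ℚ≥0) : ℝ≥0) : ℝ≥0∞) = 1 := by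
  have h1 : ∑ t, M.P s a t = 1 := by
    rcases M.sum_P s a with h0 | h1
    · exact absurd (funext fun t => (Finset.sum_eq_zero_iff.mp h0) t (Finset.mem_univ t)) h
    · exact h1
  have h2 : ∑ t, ((M.P s a t : ℚ≥0) : ℝ≥0) = 1 := by exact_mod_cast h1
  exact_mod_cast h2

namespace Scheduler

/-- The scheduler depends only on the last state of the path. -/
def IsMemoryless (𝔖 : M.Scheduler) : Prop :=
  ∀ (π π' : M.FinPath) (h : ¬ M.IsTrap π.last) (h' : ¬ M.IsTrap π'.last),
    π.last = π'.last → 𝔖.dist π h = 𝔖.dist π' h'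

/-- All scheduled distributions are Dirac distributions. -/
def IsDeterministic (𝔖 : M.Scheduler) : Prop :=
  ∀ (π : M.FinPath) (h : ¬ M.IsTrap π.last), ∃ a, 𝔖.dist π h = PMF.pure a

/-- The finite `𝔖`-paths: finite paths all of whose actions are scheduled by `𝔖` with positive
probability after the respective prefix. -/
inductive IsSchedPath (𝔖 : M.Scheduler) : M.FinPath → Prop
  | nil (s : S) : IsSchedPath 𝔖 (FinPath.nil s)
  | snoc (π : M.FinPath) (a : A) (t : S) (h : 0 < M.P π.last a t) (hn : ¬ M.IsTrap π.last) :
      IsSchedPath 𝔖 π → 0 < 𝔖.dist π hn a → IsSchedPath 𝔖 (π.snoc a t h)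

/-- The transitions `(a, t)` that are possible in state `s`. -/
abbrev Transition (M : MDP S A) (s : S) : Type _ := {p : A × S // 0 < M.P s p.1 p.2}

theorem sum_transition (𝔖 : M.Scheduler) (π : M.FinPath) (h : ¬ M.IsTrap π.last) :
    ∑ p : Transition M π.last,
      𝔖.dist π h p.1.1 * (((M.P π.last p.1.1 p.1.2 : ℚ≥0) : ℝ≥0) : ℝ≥0∞) = 1 := by
  have e1 : ∑ p : Transition M π.last,
      𝔖.dist π h p.1.1 * (((M.P π.last p.1.1 p.1.2 : ℚ≥0) : ℝ≥0) : ℝ≥0∞) =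
      ∑ p : A × S, 𝔖.dist π h p.1 * (((M.P π.last p.1 p.2 : ℚ≥0) : ℝ≥0) : ℝ≥0∞) := by
    rw [← Finset.sum_filter_of_ne (p := fun p : A × S => 0 < M.P π.last p.1 p.2)]
    · exact (Finset.sum_subtype (p := fun p : A × S => 0 < M.P π.last p.1 p.2)
        (Finset.univ.filter fun p : A × S => 0 < M.P π.last p.1 p.2) (fun x => by simp)
        (fun p : A × S =>
          𝔖.dist π h p.1 * (((M.P π.last p.1 p.2 : ℚ≥0) : ℝ≥0) : ℝ≥0∞))).symm
    · intro p _ hp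
      refine pos_iff_ne_zero.mpr fun h0 => hp ?_
      simp [h0]
  have e2 : ∀ a, 𝔖.dist π h a * ∑ t, (((M.P π.last a t : ℚ≥0) : ℝ≥0) : ℝ≥0∞) =
      𝔖.dist π h a := by
    intro a
    by_cases ha : 𝔖.dist π h a = 0
    · simp [ha]
    · rw [sum_P_eq_one (𝔖.support_subset π h ((PMF.mem_support_iff _ _).mpr ha)), mul_one]
  rw [e1, Fintype.sum_prod_type]
  simp only [← Finset.mul_sum, e2]
  rw [← tsum_fintype (L := .unconditional A)]
  exact (𝔖.dist π h).tsum_coe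

/-- One step of the process: the history `π` is extended by an action `a`, chosen with probability
`𝔖(π)(a)`, and a successor `t`, chosen with probability `P(last π, a, t)`; histories that end in a
trap stay unchanged. -/
def step (𝔖 : M.Scheduler) (π : M.FinPath) : PMF M.FinPath :=
  open Classical in
  if h : M.IsTrap π.last then PMF.pure π
  else
    (PMF.ofFintype
      (fun p : Transition M π.last =>
        𝔖.dist π h p.1.1 * (((M.P π.last p.1.1 p.1.2 : ℚ≥0) : ℝ≥0) : ℝ≥0∞))
      (𝔖.sum_transition π h)).map fun p => π.snoc p.1.1 p.1.2 p.2

end Scheduler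

/-- The countable set of finite paths carries the discrete sigma-algebra. -/
instance : MeasurableSpace M.FinPath := ⊤

namespace Scheduler

/-- The one-step kernel on finite paths. -/
def stepKernel (𝔖 : M.Scheduler) : Kernel M.FinPath M.FinPath where
  toFun π := (𝔖.step π).toMeasure
  measurable' := measurable_from_top

instance (𝔖 : M.Scheduler) : IsMarkovKernel 𝔖.stepKernel :=
  ⟨fun π => PMF.toMeasure.isProbabilityMeasure (𝔖.step π)⟩

/-- The probability measure `Pr^𝔖_s` on maximal paths starting in `s` (Ionescu-Tulcea
construction). A maximal path `ς` is represented by the sequence `ω` of its prefixes: `ω n` is the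
prefix of `ς` of length `n` or, if `ς` ends in a trap after fewer than `n` steps, `ς` itself. -/
def Pr (𝔖 : M.Scheduler) (s : S) : Measure (ℕ → M.FinPath) :=
  Kernel.traj (X := fun _ => M.FinPath)
    (fun n => 𝔖.stepKernel.comap (fun h => h ⟨n, Finset.mem_Iic.mpr le_rfl⟩)
      (measurable_pi_apply _)) 0
    (fun _ => FinPath.nil s)

end Scheduler

/-- The event `◇F`. -/
def eventually (M : MDP S A) (F : Set S) : Set (ℕ → M.FinPath) := {ω | ∃ n, (ω n).last ∈ F}

/-- The random variable that assigns to a maximal path the accumulated reward of its shortest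
prefix that ends in `F`, and `∞` if `F` is never visited. -/
def accReward (M : MDP S A) (F : Set S) (ω : ℕ → M.FinPath) : ℝ≥0∞ :=
  open Classical in
  if h : ∃ n, (ω n).last ∈ F then ((ω (Nat.find h)).rew : ℝ≥0∞) else ∞

namespace Scheduler

/-- The conditional expectation `CE^𝔖` of the accumulated reward until reaching `goal`, with
respect to `Pr^𝔖_init( · | ◇goal)`. -/
def CExp (𝔖 : M.Scheduler) (goal : S) : ℝ≥0∞ :=
  ∫⁻ ω, M.accReward {goal} ω ∂(ProbabilityTheory.cond (𝔖.Pr M.init) (M.eventually {goal}))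

/-- The scheduler requirement: `goal` is reached with positive probability, and almost surely
`goal` or `fail` is reached. -/
def IsAdmissible (𝔖 : M.Scheduler) (goal fail : S) : Prop :=
  0 < 𝔖.Pr M.init (M.eventually {goal}) ∧ 𝔖.Pr M.init (M.eventually {goal, fail}) = 1

/-- There is a finite `𝔖`-path from the initial state with a suffix that is a positive cycle. -/
def HasReachablePositiveCycle (𝔖 : M.Scheduler) : Prop :=
  ∃ (π ξ : M.FinPath) (h : ξ.first = π.last),
    π.first = M.init ∧ ξ.IsCycle ∧ ξ.IsPositive ∧ 𝔖.IsSchedPath (π.append ξ h)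

/-- Critical schedulers: almost surely `goal` is never visited (`□¬goal`), and there is a reachable
positive `𝔖`-cycle. -/
def IsCritical (𝔖 : M.Scheduler) (goal : S) : Prop :=
  𝔖.Pr M.init {ω | ∀ n, (ω n).last ≠ goal} = 1 ∧ 𝔖.HasReachablePositiveCycle

end Scheduler

/-- The supremum of `CE^𝔖` over all schedulers satisfying the scheduler requirement, with
`sup ∅ = -∞`. -/
def CExpMax (M : MDP S A) (goal fail : S) : EReal :=
  ⨆ (𝔖 : M.Scheduler) (_ : 𝔖.IsAdmissible goal fail), ((𝔖.CExp goal : ℝ≥0∞) : EReal)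

end MDP

end

/-! Suppose some critical scheduler exists. The actions it uses with positive probability span a
sub-MDP that never meets `goal` and contains a positive cycle. Shortest paths in this sub-MDP,
towards a state of the cycle with a rewarding action, turn it into a memoryless deterministic policy
with a reachable positive cycle (`IsPositiveLoop`), and that policy is itself critical. Circling
until reward `n` is collected and then heading for `goal` has positive probability of success. Since
`goal` cannot be hit before the switch, every successful path has reward at least `n`, so `CExpMax`
is infinite (`IsPositiveLoop.exists_le_CExp`).

Conversely, suppose that there is no positive loop. Let `W` be the set of states outside the
attractor of `goal`, where `goal` can be avoided. A path that has only used actions confined to `W`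
has bounded reward, because a positive cycle among such paths would be a positive loop
(`IsSafe.rew_le`). Once another action is taken, `goal` is reached with probability bounded below,
whereas the expected remaining reward is bounded above because traps are reached in bounded expected
time (`NoEndComponent.exists_stepBound`). Paths to `goal` must leave the safe regime, as `goal` is
not in `W`. Comparing the two bounds at the moment of leaving gives one constant `L` with E[reward;
`goal`] ≤ L · Pr(◇`goal`) for every scheduler (`iterate_expect_le_mul_of_isSafe`, `exists_CExp_le`).
-/

noncomputable section

/-! ### One-step expectations and the path measure -/

namespace MDP

variable {S A : Type*} [Fintype S] [Fintype A] {M : MDP S A}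

/-- Transition probabilities as extended nonnegative reals. -/
def prob (M : MDP S A) (s : S) (a : A) (t : S) : ℝ≥0∞ := ((M.P s a t : ℚ≥0) : ℝ≥0)

theorem prob_pos {s t : S} {a : A} : 0 < M.prob s a t ↔ 0 < M.P s a t := by
  simp [prob]

theorem prob_eq_zero {s t : S} {a : A} (h : ¬ 0 < M.P s a t) : M.prob s a t = 0 := by
  have : M.P s a t = 0 := by simpa using h
  simp [prob, this]

theorem mem_act_of_pos {s t : S} {a : A} (h : 0 < M.P s a t) : a ∈ M.act s := by
  intro h0
  rw [h0] at h
  simp at h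

theorem not_isTrap_of_mem_act {s : S} {a : A} (h : a ∈ M.act s) : ¬ M.IsTrap s := by
  intro h0
  rw [IsTrap] at h0
  simp [h0] at h

theorem lintegral_toMeasure_map {α β : Type*} [Fintype α] [MeasurableSpace β] (p : PMF α)
    (g : α → β) {f : β → ℝ≥0∞} (hf : Measurable f) :
    ∫⁻ y, f y ∂(p.map g).toMeasure = ∑ a, p a * f (g a) := by
  let _ : MeasurableSpace α := ⊤
  have _ : DiscreteMeasurableSpace α := ⟨fun _ => trivial⟩
  have hg : Measurable g := Measurable.of_discrete
  rw [← PMF.toMeasure_map g p hg, lintegral_map hf hg, lintegral_fintype]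
  refine Finset.sum_congr rfl fun a _ => ?_
  rw [PMF.toMeasure_apply_singleton _ _ (MeasurableSet.singleton _), mul_comm]

namespace FinPath

instance : Countable M.FinPath :=
  Function.Injective.countable (f := fun π : M.FinPath => (π.first, π.steps)) (by
    rintro ⟨s, l, h⟩ ⟨s', l', h'⟩ e
    simp only [Prod.mk.injEq] at e
    obtain ⟨rfl, rfl⟩ := e
    rfl)

instance : DiscreteMeasurableSpace M.FinPath := ⟨fun _ => trivial⟩

@[simp] theorem last_snoc (π : M.FinPath) (a : A) (t : S) (h : 0 < M.P π.last a t) :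
    (π.snoc a t h).last = t := rfl

@[simp] theorem first_snoc (π : M.FinPath) (a : A) (t : S) (h : 0 < M.P π.last a t) :
    (π.snoc a t h).first = π.first := rfl

@[simp] theorem last_nil (s : S) : (nil s : M.FinPath).last = s := rfl

@[simp] theorem pairs_nil (s : S) : (nil s : M.FinPath).pairs = [] := rfl

@[simp] theorem pairs_snoc (π : M.FinPath) (a : A) (t : S) (h : 0 < M.P π.last a t) :
    (π.snoc a t h).pairs = (π.last, a) :: π.pairs := rfl

@[simp] theorem rew_nil (s : S) : (nil s : M.FinPath).rew = 0 := rfl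

@[simp] theorem rew_snoc (π : M.FinPath) (a : A) (t : S) (h : 0 < M.P π.last a t) :
    (π.snoc a t h).rew = M.rew π.last a + π.rew := rfl

/-- Induction over finite paths by extension at the end. -/
theorem snocInduction {p : M.FinPath → Prop} (nil : ∀ s, p (nil s))
    (snoc : ∀ (π : M.FinPath) a t (h : 0 < M.P π.last a t), p π → p (π.snoc a t h))
    (π : M.FinPath) : p π := by
  obtain ⟨s, l, hl⟩ := π
  induction l with
  | nil => exact nil s
  | cons q l ih => exact snoc ⟨s, l, hl.1⟩ q.1 q.2 hl.2 (ih hl.1)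

end FinPath

theorem measurable_comp_history {E : Type*} [MeasurableSpace E] (f : M.FinPath → E) (n : ℕ) :
    Measurable fun ω : ℕ → M.FinPath => f (ω n) :=
  Measurable.comp (g := f) Measurable.of_discrete (measurable_pi_apply n)

theorem measurableSet_history (Q : M.FinPath → Prop) (n : ℕ) :
    MeasurableSet {ω : ℕ → M.FinPath | Q (ω n)} :=
  measurable_pi_apply n (MeasurableSet.of_discrete (s := {π | Q π}))

theorem measurableSet_eventually (F : Set S) : MeasurableSet (M.eventually F) := by
  rw [eventually, Set.ofPred_exists]
  exact MeasurableSet.iUnion fun n => measurableSet_history (fun π => π.last ∈ F) n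

namespace Scheduler

variable (𝔖 : M.Scheduler)

/-- The one-step expectation operator on functions of finite paths. -/
def expect (f : M.FinPath → ℝ≥0∞) (π : M.FinPath) : ℝ≥0∞ := ∫⁻ y, f y ∂𝔖.stepKernel π

/-- Markov property: the joint law of the history up to time `n` and its successor is the
composition-product of the former's law with the step kernel, which looks only at coordinate `n`.
With `lintegral_zero`, this reduces integrals over infinite paths to the operator `expect`. -/
theorem lintegral_pair (s : S) (n : ℕ) (F : M.FinPath → M.FinPath → ℝ≥0∞) :
    ∫⁻ ω, F (ω n) (ω (n + 1)) ∂𝔖.Pr s = ∫⁻ ω, 𝔖.expect (F (ω n)) (ω n) ∂𝔖.Pr s := by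
  have key := Kernel.partialTraj_compProd_eq_map_traj (X := fun _ => M.FinPath)
    (κ := fun n => 𝔖.stepKernel.comap (fun h => h ⟨n, Finset.mem_Iic.mpr le_rfl⟩)
      (measurable_pi_apply _)) (a := 0) (b := n) (Nat.zero_le n)
    (x₀ := fun _ => FinPath.nil s)
  have hF : Measurable (Function.uncurry F) := Measurable.of_discrete
  have hm : Measurable fun x : (Π _ : Finset.Iic n, M.FinPath) × M.FinPath =>
      F (x.1 ⟨n, Finset.mem_Iic.mpr le_rfl⟩) x.2 :=
    Measurable.comp (g := Function.uncurry F) (f := fun x :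
      (Π _ : Finset.Iic n, M.FinPath) × M.FinPath => (x.1 ⟨n, Finset.mem_Iic.mpr le_rfl⟩, x.2)) hF
      (Measurable.prodMk (Measurable.comp (g := fun y : Π _ : Finset.Iic n, M.FinPath =>
        y ⟨n, Finset.mem_Iic.mpr le_rfl⟩) (measurable_pi_apply _) measurable_fst) measurable_snd)
  have h1 : ∫⁻ ω, F (ω n) (ω (n + 1)) ∂𝔖.Pr s =
      ∫⁻ x, F (x.1 ⟨n, Finset.mem_Iic.mpr le_rfl⟩) x.2
        ∂((𝔖.Pr s).map fun x => (Preorder.frestrictLe n x, x (n + 1))) := by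
    rw [lintegral_map hm ((Preorder.measurable_frestrictLe n).prodMk (measurable_pi_apply _))]
    rfl
  rw [h1, Pr, ← key, Measure.lintegral_compProd hm, ← Kernel.traj_map_frestrictLe_apply,
    lintegral_map _ (Preorder.measurable_frestrictLe n)]
  · rfl
  · exact Measurable.comp (g := fun π => 𝔖.expect (F π) π) Measurable.of_discrete
      (measurable_pi_apply (⟨n, Finset.mem_Iic.mpr le_rfl⟩ : Finset.Iic n))

instance (s : S) : IsProbabilityMeasure (𝔖.Pr s) := by
  unfold Pr; infer_instance

theorem lintegral_zero (s : S) (f : M.FinPath → ℝ≥0∞) :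
    ∫⁻ ω, f (ω 0) ∂𝔖.Pr s = f (FinPath.nil s) := by
  have h1 := Kernel.traj_map_frestrictLe_apply (X := fun _ => M.FinPath)
    (κ := fun n => 𝔖.stepKernel.comap (fun h => h ⟨n, Finset.mem_Iic.mpr le_rfl⟩)
      (measurable_pi_apply _)) 0 0 (fun _ => FinPath.nil s)
  have hm : Measurable fun x : Π _ : Finset.Iic 0, M.FinPath =>
      f (x ⟨0, Finset.mem_Iic.mpr le_rfl⟩) :=
    Measurable.comp Measurable.of_discrete (measurable_pi_apply _)
  have h2 : ∫⁻ ω, f (ω 0) ∂𝔖.Pr s = ∫⁻ x, f (x ⟨0, Finset.mem_Iic.mpr le_rfl⟩)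
      ∂((𝔖.Pr s).map (Preorder.frestrictLe 0)) := by
    rw [lintegral_map hm (Preorder.measurable_frestrictLe 0)]
    rfl
  rw [h2, Pr, h1, Kernel.partialTraj_self, Kernel.id_apply, lintegral_dirac' _ hm]

/-- Expectations of functions of the history at time `n` are iterated one-step expectations. -/
theorem lintegral_history (s : S) (n : ℕ) (f : M.FinPath → ℝ≥0∞) :
    ∫⁻ ω, f (ω n) ∂𝔖.Pr s = 𝔖.expect^[n] f (FinPath.nil s) := by
  induction n generalizing f with
  | zero => exact 𝔖.lintegral_zero s f
  | succ n ih =>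
    rw [𝔖.lintegral_pair s n (fun _ => f), Function.iterate_succ_apply, ih]

theorem expect_trap {f : M.FinPath → ℝ≥0∞} {π : M.FinPath} (h : M.IsTrap π.last) :
    𝔖.expect f π = f π := by
  have : 𝔖.stepKernel π = Measure.dirac π := by
    change (𝔖.step π).toMeasure = _
    rw [step, dif_pos h, PMF.toMeasure_pure]
  rw [expect, this, lintegral_dirac' _ Measurable.of_discrete]

theorem expect_eq_sum_transition (f : M.FinPath → ℝ≥0∞) {π : M.FinPath}
    (h : ¬ M.IsTrap π.last) :
    𝔖.expect f π = ∑ p : Transition M π.last,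
      𝔖.dist π h p.1.1 * M.prob π.last p.1.1 p.1.2 * f (π.snoc p.1.1 p.1.2 p.2) := by
  have : 𝔖.stepKernel π = (𝔖.step π).toMeasure := rfl
  rw [expect, this, step, dif_neg h, lintegral_toMeasure_map _ _ Measurable.of_discrete]
  rfl

theorem sum_transition_eq {π : M.FinPath} (h : ¬ M.IsTrap π.last) (F : A → S → ℝ≥0∞) :
    ∑ p : Transition M π.last, 𝔖.dist π h p.1.1 * M.prob π.last p.1.1 p.1.2 * F p.1.1 p.1.2 =
      ∑ a, 𝔖.dist π h a * ∑ t, M.prob π.last a t * F a t := by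
  have e1 : ∑ p : Transition M π.last,
      𝔖.dist π h p.1.1 * M.prob π.last p.1.1 p.1.2 * F p.1.1 p.1.2 =
      ∑ p : A × S, 𝔖.dist π h p.1 * M.prob π.last p.1 p.2 * F p.1 p.2 := by
    rw [← Finset.sum_filter_of_ne (p := fun p : A × S => 0 < M.P π.last p.1 p.2)]
    · exact (Finset.sum_subtype (p := fun p : A × S => 0 < M.P π.last p.1 p.2)
        (Finset.univ.filter fun p : A × S => 0 < M.P π.last p.1 p.2) (fun x => by simp)
        (fun p : A × S => 𝔖.dist π h p.1 * M.prob π.last p.1 p.2 * F p.1 p.2)).symm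
    · intro p _ hp
      by_contra h0
      exact hp (by simp [prob_eq_zero h0])
  rw [e1, Fintype.sum_prod_type]
  refine Finset.sum_congr rfl fun a _ => ?_
  rw [Finset.mul_sum]
  exact Finset.sum_congr rfl fun t _ => mul_assoc _ _ _

theorem sum_dist {π : M.FinPath} (h : ¬ M.IsTrap π.last) : ∑ a, 𝔖.dist π h a = 1 := by
  rw [← tsum_fintype (L := .unconditional A)]
  exact (𝔖.dist π h).tsum_coe

theorem mem_act_of_dist_pos {π : M.FinPath} {h : ¬ M.IsTrap π.last} {a : A}
    (ha : 0 < 𝔖.dist π h a) : a ∈ M.act π.last :=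
  𝔖.support_subset π h ((PMF.mem_support_iff _ _).mpr ha.ne')

/-- The majorant `F` is defined on all pairs, possible or not. Impossible transitions have weight
zero, so the sum factors through the scheduler's distribution, and a bound for each scheduled action
survives the averaging. `le_expect` is the mirror image. -/
theorem expect_le {f : M.FinPath → ℝ≥0∞} {π : M.FinPath} (h : ¬ M.IsTrap π.last) {c : ℝ≥0∞}
    (F : A → S → ℝ≥0∞)
    (hF : ∀ a t (ht : 0 < M.P π.last a t), 0 < 𝔖.dist π h a → f (π.snoc a t ht) ≤ F a t)
    (hc : ∀ a ∈ M.act π.last, 0 < 𝔖.dist π h a → ∑ t, M.prob π.last a t * F a t ≤ c) :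
    𝔖.expect f π ≤ c := by
  calc 𝔖.expect f π ≤ ∑ p : Transition M π.last,
      𝔖.dist π h p.1.1 * M.prob π.last p.1.1 p.1.2 * F p.1.1 p.1.2 := by
        rw [𝔖.expect_eq_sum_transition f h]
        refine Finset.sum_le_sum fun p _ => ?_
        rcases eq_or_ne (𝔖.dist π h p.1.1) 0 with h0 | h0
        · simp [h0]
        · gcongr
          exact hF _ _ p.2 (pos_iff_ne_zero.mpr h0)
    _ = ∑ a, 𝔖.dist π h a * ∑ t, M.prob π.last a t * F a t := 𝔖.sum_transition_eq h F
    _ ≤ ∑ a, 𝔖.dist π h a * c := by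
        refine Finset.sum_le_sum fun a _ => ?_
        rcases eq_or_ne (𝔖.dist π h a) 0 with h0 | h0
        · simp [h0]
        · have := pos_iff_ne_zero.mpr h0
          gcongr
          exact hc a (𝔖.mem_act_of_dist_pos this) this
    _ = c := by rw [← Finset.sum_mul, 𝔖.sum_dist h, one_mul]

theorem le_expect {f : M.FinPath → ℝ≥0∞} {π : M.FinPath} (h : ¬ M.IsTrap π.last) {c : ℝ≥0∞}
    (F : A → S → ℝ≥0∞)
    (hF : ∀ a t (ht : 0 < M.P π.last a t), 0 < 𝔖.dist π h a → F a t ≤ f (π.snoc a t ht))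
    (hc : ∀ a ∈ M.act π.last, 0 < 𝔖.dist π h a → c ≤ ∑ t, M.prob π.last a t * F a t) :
    c ≤ 𝔖.expect f π := by
  calc c = ∑ a, 𝔖.dist π h a * c := by rw [← Finset.sum_mul, 𝔖.sum_dist h, one_mul]
    _ ≤ ∑ a, 𝔖.dist π h a * ∑ t, M.prob π.last a t * F a t := by
        refine Finset.sum_le_sum fun a _ => ?_
        rcases eq_or_ne (𝔖.dist π h a) 0 with h0 | h0
        · simp [h0]
        · have := pos_iff_ne_zero.mpr h0
          gcongr
          exact hc a (𝔖.mem_act_of_dist_pos this) this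
    _ = ∑ p : Transition M π.last,
          𝔖.dist π h p.1.1 * M.prob π.last p.1.1 p.1.2 * F p.1.1 p.1.2 :=
        (𝔖.sum_transition_eq h F).symm
    _ ≤ 𝔖.expect f π := by
        rw [𝔖.expect_eq_sum_transition f h]
        refine Finset.sum_le_sum fun p _ => ?_
        rcases eq_or_ne (𝔖.dist π h p.1.1) 0 with h0 | h0
        · simp [h0]
        · gcongr
          exact hF _ _ p.2 (pos_iff_ne_zero.mpr h0)

theorem iterate_expect_trap (n : ℕ) {f : M.FinPath → ℝ≥0∞} {π : M.FinPath}
    (h : M.IsTrap π.last) : 𝔖.expect^[n] f π = f π := by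
  induction n generalizing f with
  | zero => rfl
  | succ n ih => rw [Function.iterate_succ_apply, ih, 𝔖.expect_trap h]

/-- A property of finite paths that holds initially and is preserved by the scheduled transitions
holds almost surely at all times. -/
theorem ae_invariant {s : S} {Q : M.FinPath → Prop} (h0 : Q (FinPath.nil s))
    (hs : ∀ (π : M.FinPath) (a : A) (t : S) (h : 0 < M.P π.last a t) (hn : ¬ M.IsTrap π.last),
      0 < 𝔖.dist π hn a → Q π → Q (π.snoc a t h)) :
    ∀ᵐ ω ∂𝔖.Pr s, ∀ n, Q (ω n) := by
  classical
  rw [ae_all_iff]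
  let f : M.FinPath → ℝ≥0∞ := fun π => if Q π then 0 else 1
  have hiter : ∀ n π, Q π → 𝔖.expect^[n] f π = 0 := by
    intro n
    induction n with
    | zero => intro π hQ; simp [f, hQ]
    | succ n ih =>
      intro π hQ
      -- The outermost expectation is the first step from `π`, hence the induction over all starting
      -- histories.
      rw [Function.iterate_succ_apply']
      by_cases ht : M.IsTrap π.last
      · rw [𝔖.expect_trap ht, ih π hQ]
      · exact le_antisymm (𝔖.expect_le ht (fun _ _ => 0)
          (fun a t h ha => (ih _ (hs π a t h ht ha hQ)).le) (by simp)) zero_le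
  intro n
  have h1 : ∫⁻ ω, f (ω n) ∂𝔖.Pr s = 0 := by
    rw [𝔖.lintegral_history, hiter n _ h0]
  rw [lintegral_eq_zero_iff (measurable_comp_history f n)] at h1
  filter_upwards [h1] with ω hω
  by_contra hQ
  simp [f, hQ] at hω

/-- Histories that end in a trap almost surely remain unchanged. -/
theorem ae_trap_stays (s : S) :
    ∀ᵐ ω ∂𝔖.Pr s, ∀ n, M.IsTrap (ω n).last → ω (n + 1) = ω n := by
  classical
  rw [ae_all_iff]
  intro n
  let F : M.FinPath → M.FinPath → ℝ≥0∞ := fun π π' => if M.IsTrap π.last ∧ π' ≠ π then 1 else 0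
  have h1 : ∫⁻ ω, F (ω n) (ω (n + 1)) ∂𝔖.Pr s = 0 := by
    rw [𝔖.lintegral_pair]
    refine (lintegral_congr fun ω => ?_).trans lintegral_zero_fun
    by_cases ht : M.IsTrap (ω n).last
    · rw [𝔖.expect_trap ht]; simp [F]
    · have : F (ω n) = fun _ => 0 := by funext π'; simp [F, ht]
      rw [this, expect]; simp
  have hF : Measurable (Function.uncurry F) := Measurable.of_discrete
  have hm : Measurable fun ω : ℕ → M.FinPath => F (ω n) (ω (n + 1)) :=
    Measurable.comp (g := Function.uncurry F) (f := fun ω : ℕ → M.FinPath => (ω n, ω (n + 1))) hF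
      ((measurable_pi_apply n).prodMk (measurable_pi_apply (n + 1)))
  rw [lintegral_eq_zero_iff hm] at h1
  filter_upwards [h1] with ω hω ht
  by_contra hne
  simp [F, ht, hne] at hω

/-- Scheduled paths have positive probability. -/
theorem IsSchedPath.iterate_expect_pos {π : M.FinPath} (h : 𝔖.IsSchedPath π)
    {f : M.FinPath → ℝ≥0∞} (hf : 0 < f π) :
    0 < 𝔖.expect^[π.steps.length] f (FinPath.nil π.first) := by
  classical
  induction h generalizing f with
  | nil s => exact hf
  | snoc π a t h hn _ ha ih =>
    change 0 < 𝔖.expect^[π.steps.length + 1] f (FinPath.nil π.first)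
    -- The innermost expectation is the last step of the path: it makes `expect f` positive at the
    -- shorter path, which is why `f` is generalized.
    rw [Function.iterate_succ_apply]
    apply ih
    rw [𝔖.expect_eq_sum_transition f hn]
    refine lt_of_lt_of_le ?_ (Finset.single_le_sum (fun _ _ => zero_le)
      (Finset.mem_univ (⟨(a, t), h⟩ : Transition M π.last)))
    exact ENNReal.mul_pos (ENNReal.mul_pos ha.ne' (prob_pos.mpr h).ne').ne' hf.ne'

theorem IsSchedPath.pr_eventually_pos {π : M.FinPath} (h : 𝔖.IsSchedPath π) {F : Set S}
    (hF : π.last ∈ F) : 0 < 𝔖.Pr π.first (M.eventually F) := by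
  classical
  let f : M.FinPath → ℝ≥0∞ := Set.indicator {π | π.last ∈ F} 1
  have h1 := IsSchedPath.iterate_expect_pos 𝔖 h (f := f) (by simp [f, hF])
  rw [← 𝔖.lintegral_history] at h1
  refine h1.trans_le ?_
  have hms := measurableSet_history (fun π : M.FinPath => π.last ∈ F) π.steps.length
  calc _ = ∫⁻ ω, Set.indicator {ω : ℕ → M.FinPath | (ω π.steps.length).last ∈ F} 1 ω
        ∂𝔖.Pr π.first := rfl
    _ = 𝔖.Pr π.first {ω | (ω π.steps.length).last ∈ F} := lintegral_indicator_one hms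
    _ ≤ 𝔖.Pr π.first (M.eventually F) :=
        measure_mono (fun ω hω => Exists.intro π.steps.length hω)

end Scheduler

end MDP

end

/-! ### Attractors, and potentials for termination and for reaching the goal -/

noncomputable section

namespace MDP

variable {S A : Type*} [Fintype S] [Fintype A] (M : MDP S A)

/-- States from which `B` is reached within `k` steps with positive probability, whatever actions
are chosen. -/
def attr (B : Set S) : ℕ → Set S
  | 0 => B
  | k + 1 => attr B k ∪ {s | ¬ M.IsTrap s ∧ ∀ a ∈ M.act s, ∃ t ∈ attr B k, 0 < M.P s a t}

theorem attr_mono (B : Set S) : Monotone (M.attr B) :=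
  monotone_nat_of_le_succ fun _ => Set.subset_union_left

/-- The attractor of `B`, together with a rank function and the escaping actions outside. -/
theorem exists_attractor (B : Set S) : ∃ (V : Set S) (r : S → ℕ), B ⊆ V ∧
    (∀ s ∈ V, s ∉ B → ¬ M.IsTrap s ∧ ∀ a ∈ M.act s, ∃ t ∈ V, r t < r s ∧ 0 < M.P s a t) ∧
    (∀ s, s ∉ V → ¬ M.IsTrap s → ∃ a ∈ M.act s, ∀ t, 0 < M.P s a t → t ∉ V) := by
  classical
  refine ⟨⋃ k, M.attr B k, fun s => sInf {k | s ∈ M.attr B k},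
    Set.subset_iUnion (M.attr B) 0, ?_, ?_⟩
  · intro s hs hB
    have hne : {k | s ∈ M.attr B k}.Nonempty := Set.mem_iUnion.mp hs
    have hmem := Nat.sInf_mem hne
    rcases hk : sInf {k | s ∈ M.attr B k} with _ | k
    · rw [hk] at hmem
      exact absurd hmem hB
    · rw [hk] at hmem
      rcases hmem with h1 | ⟨h1, h2⟩
      · have := Nat.sInf_le (s := {k | s ∈ M.attr B k}) h1
        omega
      · refine ⟨h1, fun a ha => ?_⟩
        obtain ⟨t, ht, hp⟩ := h2 a ha
        exact ⟨t, Set.mem_iUnion.mpr ⟨k, ht⟩,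
          (Nat.lt_succ_of_le (Nat.sInf_le (s := {k | t ∈ M.attr B k}) ht)).trans_eq hk.symm, hp⟩
  · intro s hs hn
    by_contra! hc
    have : ∀ a, ∃ k, a ∈ M.act s → ∃ t ∈ M.attr B k, 0 < M.P s a t := by
      intro a
      by_cases ha : a ∈ M.act s
      · obtain ⟨t, hp, ht⟩ := hc a ha
        obtain ⟨k, hk⟩ := Set.mem_iUnion.mp ht
        exact ⟨k, fun _ => ⟨t, hk, hp⟩⟩
      · exact ⟨0, fun h => absurd h ha⟩
    choose k hk using this
    -- As there are finitely many actions, one stage serves them all, and `s` would join the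
    -- attractor at the next stage.
    refine hs (Set.mem_iUnion.mpr ⟨Finset.univ.sup k + 1, Or.inr ⟨hn, fun a ha => ?_⟩⟩)
    obtain ⟨t, ht, hp⟩ := hk a ha
    exact ⟨t, M.attr_mono B (Finset.le_sup (Finset.mem_univ a)) ht, hp⟩

variable {M}

/-- A nonempty set of states in which one can stay forever contains an end component. -/
theorem NoEndComponent.eq_empty (h : M.NoEndComponent) (X : Set S)
    (hX : ∀ s ∈ X, ∃ a ∈ M.act s, ∀ t, 0 < M.P s a t → t ∈ X) : X = ∅ := by
  classical
  by_contra hne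
  have hne : X.Nonempty := Set.nonempty_iff_ne_empty.mpr hne
  have : ∀ s, ∃ a, s ∈ X → a ∈ M.act s ∧ ∀ t, 0 < M.P s a t → t ∈ X := by
    intro s
    by_cases hs : s ∈ X
    · obtain ⟨a, ha⟩ := hX s hs
      exact ⟨a, fun _ => ha⟩
    · obtain ⟨s', hs'⟩ := hne
      obtain ⟨a, -⟩ := hX s' hs'
      exact ⟨a, fun h => absurd h hs⟩
  choose f hf using this
  -- A minimal nonempty set closed under the selector `f` is strongly connected: the states
  -- reachable from any of its points form a smaller member of `C`, hence all of it.
  let C : Set (Set S) := {E | E.Nonempty ∧ E ⊆ X ∧ ∀ s ∈ E, ∀ t, 0 < M.P s (f s) t → t ∈ E}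
  obtain ⟨E, hE⟩ := (Set.toFinite C).exists_minimal
    ⟨X, hne, subset_rfl, fun s hs => (hf s hs).2⟩
  obtain ⟨hE1, hE2, hE3⟩ := hE.prop
  refine h E (fun s => {f s}) ⟨hE1, fun _ _ => Set.singleton_nonempty _, ?_, ?_, ?_⟩
  · rintro s hs a rfl
    exact (hf s (hE2 hs)).1
  · rintro s hs a rfl
    exact hE3 s hs
  · intro s hs t ht
    let R : S → S → Prop := fun u v => u ∈ E ∧ ∃ a ∈ ({f u} : Set A), 0 < M.P u a v
    have hsub : {u | Relation.ReflTransGen R s u} ⊆ E := by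
      intro u hu
      induction hu with
      | refl => exact hs
      | tail _ h2 ih =>
        obtain ⟨-, a, rfl, hp⟩ := h2
        exact hE3 _ ih _ hp
    have hC : {u | Relation.ReflTransGen R s u} ∈ C :=
      ⟨⟨s, Relation.ReflTransGen.refl⟩, hsub.trans hE2, fun u hu v hp =>
        Relation.ReflTransGen.tail hu ⟨hsub hu, f u, rfl, hp⟩⟩
    exact hE.le_of_le hC hsub ht

variable (M) in
theorem exists_pos_le_P : ∃ p : ℚ≥0, 0 < p ∧ p ≤ 1 ∧ ∀ s a t, 0 < M.P s a t → p ≤ M.P s a t := by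
  classical
  -- Inserting 1 makes the set nonempty and forces `p ≤ 1`.
  let X : Finset ℚ≥0 := insert 1
    ((Finset.univ.image fun q : S × A × S => M.P q.1 q.2.1 q.2.2).filter fun x => 0 < x)
  have hX : X.Nonempty := ⟨1, Finset.mem_insert_self _ _⟩
  refine ⟨X.min' hX, ?_, X.min'_le _ (Finset.mem_insert_self _ _), fun s a t h => X.min'_le _ ?_⟩
  · rcases Finset.mem_insert.mp (X.min'_mem hX) with h | h
    · rw [h]; exact one_pos
    · exact (Finset.mem_filter.mp h).2
  · exact Finset.mem_insert_of_mem (Finset.mem_filter.mpr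
      ⟨Finset.mem_image.mpr ⟨(s, a, t), Finset.mem_univ _, rfl⟩, h⟩)

theorem sum_prob {s : S} {a : A} (h : a ∈ M.act s) : ∑ t, M.prob s a t = 1 := sum_P_eq_one h

theorem sum_prob_mul_ofReal (s : S) (a : A) {v : S → ℝ} (hv : ∀ t, 0 ≤ v t) :
    ∑ t, M.prob s a t * ENNReal.ofReal (v t) =
      ENNReal.ofReal (∑ t, ((M.P s a t : ℚ≥0) : ℝ) * v t) := by
  rw [ENNReal.ofReal_sum_of_nonneg fun t _ => mul_nonneg (by positivity) (hv t)]
  refine Finset.sum_congr rfl fun t _ => ?_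
  rw [ENNReal.ofReal_mul (by positivity)]
  congr 1
  rw [prob, ← ENNReal.ofReal_coe_nnreal]
  rfl

/-- Without end components, the expected number of steps until a trap is reached has a finite
bound that works for all schedulers. -/
theorem NoEndComponent.exists_stepBound (h : M.NoEndComponent) : ∃ v : S → ℝ≥0∞,
    (∀ s, v s ≠ ∞) ∧ ∀ s, ∀ a ∈ M.act s, 1 + ∑ t, M.prob s a t * v t ≤ v s := by
  obtain ⟨V, r, hB, hV, hV'⟩ := M.exists_attractor {s | M.IsTrap s}
  have hVall : ∀ s, s ∈ V := by
    intro s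
    by_contra hs
    have : Vᶜ = ∅ := h.eq_empty _ fun u hu => hV' u hu fun ht => hu (hB ht)
    exact (this ▸ (show s ∈ Vᶜ from hs) : s ∈ (∅ : Set S))
  obtain ⟨p, hp0, hp1, hp⟩ := M.exists_pos_le_P
  let N := Finset.univ.sup r
  have hN : ∀ s, r s ≤ N := fun s => Finset.le_sup (Finset.mem_univ s)
  let c : ℝ := 2 / (p : ℝ)
  have hp0' : (0 : ℝ) < p := by exact_mod_cast hp0
  have hp1' : (p : ℝ) ≤ 1 := by exact_mod_cast hp1
  have hc : 1 ≤ c := by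
    rw [le_div_iff₀ hp0']
    linarith
  have hpc : (p : ℝ) * c = 2 := mul_div_cancel₀ _ hp0'.ne'
  -- Each action reaches a lower rank with probability at least `p`. By the choice `c = 2 / p`, that
  -- successor alone contributes at least `p * c ^ (N - r s + 1) = 2 * c ^ (N - r s) ≥ 1 + c ^ (N -
  -- r s)` to the mean of `c ^ (N - r t)`, so `v` drops by at least 1 on average.
  let v : S → ℝ := fun s => c ^ N - c ^ (N - r s)
  have hv : ∀ s, 0 ≤ v s := fun s => sub_nonneg.mpr (pow_le_pow_right₀ hc (Nat.sub_le _ _))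
  refine ⟨fun s => ENNReal.ofReal (v s), fun s => ENNReal.ofReal_ne_top, fun s a ha => ?_⟩
  rw [sum_prob_mul_ofReal s a hv, ← ENNReal.ofReal_one, ← ENNReal.ofReal_add zero_le_one
    (Finset.sum_nonneg fun t _ => mul_nonneg (by positivity) (hv t))]
  refine ENNReal.ofReal_le_ofReal ?_
  obtain ⟨-, hr⟩ := hV s (hVall s) (not_isTrap_of_mem_act ha)
  obtain ⟨t, -, hlt, hpos⟩ := hr a ha
  have hsum : ∑ t, ((M.P s a t : ℚ≥0) : ℝ) = 1 := by
    have := sum_prob ha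
    have h2 := sum_prob_mul_ofReal (M := M) s a (v := fun _ => 1) fun _ => zero_le_one
    simp only [ENNReal.ofReal_one, mul_one, this] at h2
    exact (ENNReal.ofReal_eq_one.mp h2.symm)
  have hle : ((M.P s a t : ℚ≥0) : ℝ) * c ^ (N - r t) ≤
      ∑ t, ((M.P s a t : ℚ≥0) : ℝ) * c ^ (N - r t) :=
    Finset.single_le_sum (f := fun t => ((M.P s a t : ℚ≥0) : ℝ) * c ^ (N - r t))
      (fun t _ => by positivity) (Finset.mem_univ t)
  have h1 : (p : ℝ) * c ^ (N - r s + 1) ≤ ((M.P s a t : ℚ≥0) : ℝ) * c ^ (N - r t) := by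
    gcongr
    · exact_mod_cast hp s a t hpos
    · have := hN s
      omega
  have h2 : (p : ℝ) * c ^ (N - r s + 1) = 2 * c ^ (N - r s) := by
    rw [pow_succ, mul_left_comm, hpc, mul_comm]
  have h3 : (1 : ℝ) ≤ c ^ (N - r s) := one_le_pow₀ hc
  simp only [v, mul_sub, Finset.sum_sub_distrib, ← Finset.sum_mul, hsum]
  linarith

/-- There is a set `W` in which `goal` can be avoided forever, and a positive lower bound for the
probability of reaching `goal` from the other states. -/
theorem exists_goalBound (goal : S) (hgoal : M.IsTrap goal) : ∃ (W : Set S) (w : S → ℝ≥0∞),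
    goal ∉ W ∧ (∀ s ∉ W, 0 < w s) ∧ (∀ s, w s ≤ 1) ∧
    (∀ s, M.IsTrap s → s ≠ goal → w s = 0) ∧
    (∀ s, ∀ a ∈ M.act s, w s ≤ ∑ t, M.prob s a t * w t) ∧
    (∀ s ∈ W, ¬ M.IsTrap s → ∃ a ∈ M.act s, ∀ t, 0 < M.P s a t → t ∈ W) := by
  classical
  obtain ⟨V, r, hB, hV, hV'⟩ := M.exists_attractor {goal}
  obtain ⟨p, hp0, hp1, hp⟩ := M.exists_pos_le_P
  let q : ℝ≥0∞ := ((p : ℝ≥0) : ℝ≥0∞)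
  have hq0 : 0 < q := by simpa [q] using hp0
  have hq1 : q ≤ 1 := by
    have : (p : ℝ≥0) ≤ 1 := by exact_mod_cast hp1
    exact ENNReal.coe_le_one_iff.mpr this
  have hq : ∀ s a t, 0 < M.P s a t → q ≤ M.prob s a t := by
    intro s a t h
    have : (p : ℝ≥0) ≤ ((M.P s a t : ℚ≥0) : ℝ≥0) := by exact_mod_cast hp s a t h
    exact ENNReal.coe_le_coe.mpr this
  -- Descending one rank has probability at least `q`, so `q ^ r s` is subharmonic on the attractor;
  -- off it, the value 0 makes the inequality trivial.
  refine ⟨Vᶜ, fun s => if s ∈ V then q ^ r s else 0, fun h => h (hB rfl),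
    fun s hs => ?_, fun s => ?_, fun s ht hne => ?_, fun s a ha => ?_, hV'⟩
  · beta_reduce
    rw [if_pos (not_not.mp hs)]
    exact ENNReal.pow_pos hq0 _
  · beta_reduce
    split_ifs
    · exact pow_le_one₀ zero_le hq1
    · exact zero_le
  · refine if_neg fun hs => ?_
    exact (hV s hs hne).1 ht
  · beta_reduce
    by_cases hs : s ∈ V
    · rw [if_pos hs]
      have hne : s ∉ ({goal} : Set S) := by
        rintro rfl
        exact not_isTrap_of_mem_act ha hgoal
      obtain ⟨t, htV, hlt, hpos⟩ := (hV s hs hne).2 a ha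
      refine le_trans ?_ (Finset.single_le_sum (fun _ _ => zero_le) (Finset.mem_univ t))
      rw [if_pos htV]
      calc q ^ r s ≤ q ^ (r t + 1) := pow_le_pow_of_le_one zero_le hq1 hlt
        _ = q * q ^ r t := pow_succ' _ _
        _ ≤ _ := by gcongr; exact hq s a t hpos
    · rw [if_neg hs]
      exact zero_le

/-- The indicator of the finite paths that do not end in a trap. -/
def notTrap (π : M.FinPath) : ℝ≥0∞ :=
  open Classical in if M.IsTrap π.last then 0 else 1

open Filter Topology in
/-- Without end components, every scheduler reaches a trap almost surely. -/
theorem NoEndComponent.tendsto_notTrap (h : M.NoEndComponent) (𝔖 : M.Scheduler) (s : S) :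
    Tendsto (fun n => ∫⁻ ω, notTrap (ω n) ∂𝔖.Pr s) atTop (𝓝 0) := by
  obtain ⟨v, hv, hv'⟩ := h.exists_stepBound
  let f : M.FinPath → ℝ≥0∞ := fun π => v π.last
  -- The potential falls by at least 1 on average outside traps. Telescoping bounds the sum over all
  -- times of the probabilities of not being in a trap, so these tend to zero.
  have hstep : ∀ π, notTrap π + 𝔖.expect f π ≤ f π := by
    intro π
    by_cases ht : M.IsTrap π.last
    · rw [𝔖.expect_trap ht, notTrap, if_pos ht, zero_add]
    · rw [notTrap, if_neg ht]
      -- Needed to undo the truncated subtraction in `f π - 1`.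
      have hone : 1 ≤ f π := by
        obtain ⟨a, ha⟩ := Set.nonempty_iff_ne_empty.mpr ht
        exact le_self_add.trans (hv' _ a ha)
      have : 𝔖.expect f π ≤ f π - 1 := by
        refine 𝔖.expect_le ht (fun _ t => v t) (fun a t _ _ => le_rfl) fun a ha _ => ?_
        exact ENNReal.le_sub_of_add_le_left ENNReal.one_ne_top (hv' _ a ha)
      calc 1 + 𝔖.expect f π ≤ 1 + (f π - 1) := by gcongr
        _ = f π := add_tsub_cancel_of_le hone
  have hsum : ∀ n, ∑ i ∈ Finset.range n, ∫⁻ ω, notTrap (ω i) ∂𝔖.Pr s +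
      ∫⁻ ω, f (ω n) ∂𝔖.Pr s ≤ v s := by
    intro n
    induction n with
    | zero => rw [Finset.range_zero, Finset.sum_empty, zero_add, 𝔖.lintegral_zero]; rfl
    | succ n ih =>
      refine le_trans ?_ ih
      rw [Finset.sum_range_succ, add_assoc, 𝔖.lintegral_pair s n fun _ => f,
        ← lintegral_add_left (measurable_comp_history notTrap n)]
      gcongr with ω
      exact hstep (ω n)
  refine ENNReal.tendsto_atTop_zero_of_tsum_ne_top (ne_top_of_le_ne_top (hv s) ?_)
  exact ENNReal.tsum_le_of_sum_range_le fun n => le_self_add.trans (hsum n)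

end MDP

end

/-! ### Memoryless policies and positive loops -/

noncomputable section

namespace MDP

theorem pairsOf_append {S A : Type*} (s : S) (l l' : List (A × S)) :
    pairsOf s (l' ++ l) = pairsOf (lastOf s l) l' ++ pairsOf s l := by
  induction l' with
  | nil => rfl
  | cons q l' ih =>
    change (lastOf s (l' ++ l), q.1) :: pairsOf s (l' ++ l) = _
    rw [ih, lastOf_append]
    rfl

variable {S A : Type*} [Fintype S] [Fintype A] (M : MDP S A)

/-- The transition graph of the sub-MDP with action sets `𝔅`. -/
def Step (𝔅 : S → Set A) (u v : S) : Prop := ∃ a ∈ 𝔅 u, 0 < M.P u a v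

/-- The transition graph of a memoryless deterministic policy. -/
def PolicyStep (f : S → A) (u v : S) : Prop := 0 < M.P u (f u) v

/-- `t` is reached in exactly `n` steps of the sub-MDP with action sets `𝔅`. -/
def StepsTo (𝔅 : S → Set A) (t : S) : ℕ → S → Prop
  | 0, u => u = t
  | n + 1, u => ∃ v, M.Step 𝔅 u v ∧ StepsTo 𝔅 t n v

variable {M}

theorem canReach_iff {s t : S} :
    M.CanReach s t ↔ Relation.ReflTransGen (M.Step fun _ => Set.univ) s t := by
  constructor
  · rintro ⟨π, rfl, rfl⟩
    induction π using FinPath.snocInduction with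
    | nil s => exact Relation.ReflTransGen.refl
    | snoc π a t h ih => exact Relation.ReflTransGen.tail ih ⟨a, Set.mem_univ _, h⟩
  · intro h
    induction h with
    | refl => exact ⟨FinPath.nil s, rfl, rfl⟩
    | tail _ h2 ih =>
      obtain ⟨π, h1, rfl⟩ := ih
      obtain ⟨a, -, hp⟩ := h2
      exact ⟨π.snoc a _ hp, h1, rfl⟩

/-- A successor of `fail` that could reach `goal` would let `fail` reach it too. So an action
enabled in `fail` could only loop there, making `{fail}` an end component. -/
theorem isTrap_fail {goal fail : S} (hA1 : ∀ s : S, ¬ M.CanReach s goal ↔ s = fail)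
    (hA2 : M.NoEndComponent) : M.IsTrap fail := by
  by_contra hn
  obtain ⟨a, ha⟩ := Set.nonempty_iff_ne_empty.mpr hn
  have : ({fail} : Set S) = ∅ := hA2.eq_empty _ (by
    intro u hu
    rw [Set.mem_singleton_iff.mp hu]
    refine ⟨a, ha, fun t ht => ?_⟩
    by_contra hne
    have ht' : M.CanReach t goal := by
      by_contra hc
      exact hne ((hA1 t).mp hc)
    exact (hA1 fail).mpr rfl
      (canReach_iff.mpr (Relation.ReflTransGen.head ⟨a, Set.mem_univ _, ht⟩ (canReach_iff.mp ht'))))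
  exact Set.singleton_ne_empty _ this

theorem eq_of_isTrap {goal fail : S} (hA1 : ∀ s : S, ¬ M.CanReach s goal ↔ s = fail) {s : S}
    (hs : M.IsTrap s) (hne : s ≠ fail) : s = goal := by
  have h : M.CanReach s goal := by
    by_contra hc
    exact hne ((hA1 s).mp hc)
  rcases Relation.ReflTransGen.cases_head (canReach_iff.mp h) with h | ⟨t, ⟨a, -, hp⟩, -⟩
  · exact h
  · exact absurd hs (not_isTrap_of_mem_act (mem_act_of_pos hp))

/-- A memoryless deterministic policy that follows shortest paths to `t` where possible and the
default policy elsewhere. -/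
theorem exists_policy (𝔅 : S → Set A) (d : S → A) (t : S) : ∃ f : S → A, f t = d t ∧
    (∀ u, f u = d u ∨ f u ∈ 𝔅 u ∩ M.act u) ∧
    ∀ u, Relation.ReflTransGen (M.Step 𝔅) u t → Relation.ReflTransGen (M.PolicyStep f) u t := by
  classical
  let D : ℕ → S → Prop := M.StepsTo 𝔅 t
  have hD : ∀ u, Relation.ReflTransGen (M.Step 𝔅) u t → ∃ n, D n u := by
    intro u h
    induction h using Relation.ReflTransGen.head_induction_on with
    | refl => exact ⟨0, rfl⟩
    | head h _ ih =>
      obtain ⟨n, hn⟩ := ih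
      exact ⟨n + 1, _, h, hn⟩
  -- Away from `t` the action starts a shortest path. Minimality is stated for an arbitrary `n`, so
  -- that the later strong induction needs no distance function.
  have hchoice : ∀ u, ∃ a, (u = t → a = d u) ∧ (a = d u ∨ a ∈ 𝔅 u ∩ M.act u) ∧
      ∀ n, u ≠ t → D n u → (∀ m < n, ¬ D m u) → ∃ v, 0 < M.P u a v ∧ ∃ m < n, D m v := by
    intro u
    by_cases h : u ≠ t ∧ ∃ n, D n u
    · obtain ⟨hne, hex⟩ := h
      rcases hk : Nat.find hex with _ | k
      · have := Nat.find_spec hex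
        rw [hk] at this
        exact absurd this hne
      · have := Nat.find_spec hex
        rw [hk] at this
        obtain ⟨v, ⟨a, ha, hp⟩, hv⟩ := this
        refine ⟨a, fun h => absurd h hne, Or.inr ⟨ha, mem_act_of_pos hp⟩, fun n _ hn hmin => ?_⟩
        refine ⟨v, hp, k, ?_, hv⟩
        have := Nat.find_min' hex hn
        omega
    · exact ⟨d u, fun _ => rfl, Or.inl rfl, fun n hne hn _ => absurd ⟨hne, n, hn⟩ h⟩
  choose f hf1 hf2 hf3 using hchoice
  refine ⟨f, hf1 t rfl, hf2, fun u hu => ?_⟩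
  obtain ⟨n, hn⟩ := hD u hu
  clear hu
  induction n using Nat.strong_induction_on generalizing u with
  | _ n ih =>
    by_cases hut : u = t
    · rw [hut]
    · by_cases hmin : ∀ m < n, ¬ D m u
      · obtain ⟨v, hp, m, hm, hv⟩ := hf3 u n hut hn hmin
        exact Relation.ReflTransGen.head hp (ih m hm v hv)
      · push Not at hmin
        obtain ⟨m, hm, hmu⟩ := hmin
        exact ih m hm u hmu

namespace Scheduler

/-- The deterministic scheduler given by a choice of enabled actions. -/
def ofFun (f : M.FinPath → A) (hf : ∀ π, ¬ M.IsTrap π.last → f π ∈ M.act π.last) :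
    M.Scheduler where
  dist π _ := PMF.pure (f π)
  support_subset π h := by
    rw [PMF.support_pure, Set.singleton_subset_iff]
    exact hf π h

variable {f : M.FinPath → A} {hf : ∀ π, ¬ M.IsTrap π.last → f π ∈ M.act π.last}

theorem ofFun_dist_pos {π : M.FinPath} {h : ¬ M.IsTrap π.last} {a : A} :
    0 < (ofFun f hf).dist π h a ↔ a = f π := by
  classical
  simp [ofFun, PMF.pure_apply, pos_iff_ne_zero]

theorem IsSchedPath.snoc_ofFun {π : M.FinPath} (h : (ofFun f hf).IsSchedPath π) {a : A} {t : S}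
    (ha : a = f π) (hp : 0 < M.P π.last a t) : (ofFun f hf).IsSchedPath (π.snoc a t hp) :=
  IsSchedPath.snoc π a t hp (not_isTrap_of_mem_act (mem_act_of_pos hp)) h (ofFun_dist_pos.mpr ha)

theorem isDeterministic_ofFun : (ofFun f hf).IsDeterministic := fun π _ => ⟨f π, rfl⟩

end Scheduler

/-- A memoryless deterministic policy `f` with a set `T` of states, closed under `f`, that
contains the initial state but not `goal`, and with a reachable positive cycle through `s₀`. -/
structure IsPositiveLoop (M : MDP S A) (goal : S) (f : S → A) (T : Set S) (s₀ t₀ : S) : Prop where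
  enabled : ∀ u, ¬ M.IsTrap u → f u ∈ M.act u
  init_mem : M.init ∈ T
  closed : ∀ u ∈ T, ∀ v, 0 < M.P u (f u) v → v ∈ T
  goal_notMem : goal ∉ T
  reach : Relation.ReflTransGen (M.PolicyStep f) M.init s₀
  step : M.PolicyStep f s₀ t₀
  back : Relation.ReflTransGen (M.PolicyStep f) t₀ s₀
  rew_pos : 0 < M.rew s₀ (f s₀)

/-- A positive cycle in a sub-MDP that avoids `goal` yields a memoryless deterministic policy with
a positive cycle. -/
theorem exists_isPositiveLoop {goal : S} (T : Set S) (𝔅 : S → Set A)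
    (hact : ∀ u ∈ T, ¬ M.IsTrap u → (𝔅 u ∩ M.act u).Nonempty)
    (hclosed : ∀ u ∈ T, ∀ a ∈ 𝔅 u, ∀ v, 0 < M.P u a v → v ∈ T)
    (hinit : M.init ∈ T) (hgoal : goal ∉ T) {s t : S} {a : A}
    (hs : Relation.ReflTransGen (M.Step 𝔅) M.init s) (ha : a ∈ 𝔅 s) (hp : 0 < M.P s a t)
    (ht : Relation.ReflTransGen (M.Step 𝔅) t s) (hrew : 0 < M.rew s a) :
    ∃ f, M.IsPositiveLoop goal f T s t := by
  classical
  -- `exists_policy` keeps the default at its target `s`, so the rewarding action `a` survives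
  -- there; on `T` the default stays in `𝔅`, so the policy does not leave `T`.
  have hd : ∀ u, ∃ b, (¬ M.IsTrap u → b ∈ M.act u) ∧ (u ∈ T → ¬ M.IsTrap u → b ∈ 𝔅 u) ∧
      (u = s → b = a) := by
    intro u
    by_cases hus : u = s
    · subst hus
      exact ⟨a, fun _ => mem_act_of_pos hp, fun _ _ => ha, fun _ => rfl⟩
    · by_cases hu : M.IsTrap u
      · exact ⟨a, fun h => absurd hu h, fun _ h => absurd hu h, fun h => absurd h hus⟩
      · by_cases huT : u ∈ T
        · obtain ⟨b, hb⟩ := hact u huT hu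
          exact ⟨b, fun _ => hb.2, fun _ _ => hb.1, fun h => absurd h hus⟩
        · obtain ⟨b, hb⟩ := Set.nonempty_iff_ne_empty.mpr hu
          exact ⟨b, fun _ => hb, fun h => absurd h huT, fun h => absurd h hus⟩
  choose d hd1 hd2 hd3 using hd
  obtain ⟨f, hf1, hf2, hf3⟩ := exists_policy (M := M) 𝔅 d s
  have hfs : f s = a := hf1.trans (hd3 s rfl)
  refine ⟨f, fun u hu => ?_, hinit, fun u hu v hv => ?_, hgoal, hf3 _ hs, ?_, hf3 _ ht, ?_⟩
  · rcases hf2 u with h | h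
    · rw [h]; exact hd1 u hu
    · exact h.2
  · refine hclosed u hu _ ?_ v hv
    rcases hf2 u with h | h
    · rw [h]; exact hd2 u hu (not_isTrap_of_mem_act (mem_act_of_pos hv))
    · exact h.1
  · rw [PolicyStep, hfs]; exact hp
  · rw [hfs]; exact hrew

/-- The paths of a memoryless deterministic policy. -/
def FollowsPolicy (f : S → A) (π : M.FinPath) : Prop := ∀ p ∈ π.pairs, p.2 = f p.1

theorem exists_followsPolicy {f : S → A} {s t : S}
    (h : Relation.ReflTransGen (M.PolicyStep f) s t) :
    ∃ π : M.FinPath, π.first = s ∧ π.last = t ∧ FollowsPolicy f π := by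
  induction h with
  | refl => exact ⟨FinPath.nil s, rfl, rfl, by simp [FollowsPolicy]⟩
  | tail _ h2 ih =>
    obtain ⟨π, h1, rfl, hπ⟩ := ih
    refine ⟨π.snoc (f π.last) _ h2, h1, rfl, ?_⟩
    intro p hp
    rcases List.mem_cons.mp hp with rfl | hp
    · rfl
    · exact hπ p hp

namespace FinPath

theorem pairs_append (π ξ : M.FinPath) (h : ξ.first = π.last) :
    (π.append ξ h).pairs = ξ.pairs ++ π.pairs := by
  change pairsOf π.first (ξ.steps ++ π.steps) = pairsOf ξ.first ξ.steps ++ _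
  rw [pairsOf_append, h]
  rfl

theorem last_append (π ξ : M.FinPath) (h : ξ.first = π.last) :
    (π.append ξ h).last = ξ.last := by
  change lastOf π.first (ξ.steps ++ π.steps) = lastOf ξ.first ξ.steps
  rw [lastOf_append, h]
  rfl

end FinPath

theorem FollowsPolicy.append {f : S → A} {π ξ : M.FinPath} (h : ξ.first = π.last)
    (hπ : FollowsPolicy f π) (hξ : FollowsPolicy f ξ) : FollowsPolicy f (π.append ξ h) := by
  intro p hp
  rw [FinPath.pairs_append] at hp
  rcases List.mem_append.mp hp with hp | hp
  · exact hξ p hp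
  · exact hπ p hp

theorem FollowsPolicy.isSchedPath {f : S → A}
    {hf : ∀ π : M.FinPath, ¬ M.IsTrap π.last → f π.last ∈ M.act π.last} {π : M.FinPath}
    (h : FollowsPolicy f π) : (Scheduler.ofFun (fun π => f π.last) hf).IsSchedPath π := by
  induction π using FinPath.snocInduction with
  | nil s => exact Scheduler.IsSchedPath.nil s
  | snoc π a t hp ih =>
    exact (ih fun p hp => h p (List.mem_cons_of_mem _ hp)).snoc_ofFun
      (h (π.last, a) (List.mem_cons_self)) hp

/-- A positive loop gives a memoryless deterministic critical scheduler. -/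
theorem IsPositiveLoop.exists_critical {goal : S} {f : S → A} {T : Set S} {s₀ t₀ : S}
    (h : M.IsPositiveLoop goal f T s₀ t₀) :
    ∃ 𝔘 : M.Scheduler, 𝔘.IsMemoryless ∧ 𝔘.IsDeterministic ∧ 𝔘.IsCritical goal := by
  let 𝔘 := Scheduler.ofFun (fun π : M.FinPath => f π.last) fun π hn => h.enabled _ hn
  refine ⟨𝔘, fun π π' _ _ e => ?_, Scheduler.isDeterministic_ofFun, ?_, ?_⟩
  · change PMF.pure (f π.last) = PMF.pure (f π'.last)
    rw [e]
  · have hinv := 𝔘.ae_invariant (s := M.init) (Q := fun π => π.last ∈ T) h.init_mem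
      (fun π a t hp hn ha hπ => by
        rw [Scheduler.ofFun_dist_pos] at ha
        subst ha
        exact h.closed _ hπ t hp)
    rw [← prob_compl_eq_zero_iff]
    · refine measure_mono_null (fun ω hω => ?_) hinv
      intro hT
      refine hω fun n hn => h.goal_notMem ?_
      rw [← hn]
      exact hT n
    · rw [Set.ofPred_forall]
      exact MeasurableSet.iInter fun n => measurableSet_history (fun π => π.last ≠ goal) n
  · obtain ⟨π, hπ1, hπ2, hπ⟩ := exists_followsPolicy h.reach
    obtain ⟨ξ, hξ1, hξ2, hξ⟩ := exists_followsPolicy h.back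
    have hone : 0 < M.P (FinPath.nil s₀ : M.FinPath).last (f s₀) t₀ := h.step
    let ρ : M.FinPath := (FinPath.nil s₀).snoc (f s₀) t₀ hone
    have hρ : FollowsPolicy f ρ := by
      intro p hp
      have : p = (s₀, f s₀) := by simpa [ρ] using hp
      rw [this]
    have hρξ : ξ.first = ρ.last := hξ1
    have hfirst : (ρ.append ξ hρξ).first = π.last := hπ2.symm
    refine ⟨π, ρ.append ξ hρξ, hfirst, hπ1, ⟨?_, ?_⟩, ⟨(s₀, f s₀), ?_, h.rew_pos⟩, ?_⟩
    · exact List.append_ne_nil_of_right_ne_nil _ (List.cons_ne_nil _ _)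
    · rw [FinPath.last_append, hξ2]
      rfl
    · rw [FinPath.pairs_append]
      exact List.mem_append_right _ (by simp [ρ])
    · exact (hπ.append hfirst (hρ.append hρξ hξ)).isSchedPath

end MDP

end

/-! ### From critical schedulers to unbounded conditional expectations -/

noncomputable section

namespace MDP

variable {S A : Type*} [Fintype S] [Fintype A] {M : MDP S A}

/-- A trap is `goal` or `fail`, and traps are reached almost surely. Hence half of admissibility is
automatic. -/
theorem pr_eventually_goal_fail (𝔖 : M.Scheduler) {goal fail : S}
    (hA1 : ∀ s : S, ¬ M.CanReach s goal ↔ s = fail) (hA2 : M.NoEndComponent) (s : S) :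
    𝔖.Pr s (M.eventually {goal, fail}) = 1 := by
  rw [← prob_compl_eq_zero_iff (measurableSet_eventually _)]
  refine le_antisymm (ge_of_tendsto' (hA2.tendsto_notTrap 𝔖 s) fun n => ?_) zero_le
  rw [← lintegral_indicator_one (measurableSet_eventually _).compl]
  refine lintegral_mono fun ω => ?_
  by_cases hω : ω ∈ M.eventually {goal, fail}
  · simp [hω]
  · have hn : ¬ M.IsTrap (ω n).last := fun ht => hω ⟨n, by
      by_cases hf : (ω n).last = fail
      · exact Or.inr hf
      · exact Or.inl (eq_of_isTrap hA1 ht hf)⟩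
    simp [hω, notTrap, hn]

/-- A positive loop gives schedulers with arbitrarily large conditional expectations: the loop is
repeated until reward `n` has been collected, and only then `goal` is approached. -/
theorem IsPositiveLoop.exists_le_CExp {goal fail : S}
    (hA1 : ∀ s : S, ¬ M.CanReach s goal ↔ s = fail) (hA2 : M.NoEndComponent)
    {f : S → A} {T : Set S} {s₀ t₀ : S} (h : M.IsPositiveLoop goal f T s₀ t₀) (n : ℕ) :
    ∃ 𝔖 : M.Scheduler, 𝔖.IsAdmissible goal fail ∧ (n : ℝ≥0∞) ≤ 𝔖.CExp goal := by
  classical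
  obtain ⟨g, -, hg, hreach⟩ := exists_policy (M := M) (fun _ => Set.univ) f goal
  let c : M.FinPath → A := fun π => if n ≤ π.rew then g π.last else f π.last
  have hc : ∀ π : M.FinPath, ¬ M.IsTrap π.last → c π ∈ M.act π.last := by
    intro π hn
    simp only [c]
    split_ifs
    · rcases hg π.last with h1 | h1
      · rw [h1]; exact h.enabled _ hn
      · exact h1.2
    · exact h.enabled _ hn
  let 𝔖 := Scheduler.ofFun c hc
  have hs₀ : ¬ M.IsTrap s₀ := not_isTrap_of_mem_act (mem_act_of_pos h.step)
  -- The last clause shows that the end of the path is not the trap `fail`, so `goal` is still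
  -- reachable after the switch.
  let Good : M.FinPath → Prop := fun π =>
    𝔖.IsSchedPath π ∧ π.first = M.init ∧ Relation.ReflTransGen (M.PolicyStep f) π.last s₀
  have hwalk : ∀ u, Relation.ReflTransGen (M.PolicyStep f) u s₀ → ∀ π, Good π → π.last = u →
      ∃ π', Good π' ∧ π.rew ≤ π'.rew ∧ (n ≤ π'.rew ∨ π'.last = s₀) := by
    intro u hu
    induction hu using Relation.ReflTransGen.head_induction_on with
    | refl => exact fun π hπ e => ⟨π, hπ, le_rfl, Or.inr e⟩
    | head h1 h2 ih =>
      rintro π hπ rfl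
      by_cases hle : n ≤ π.rew
      · exact ⟨π, hπ, le_rfl, Or.inl hle⟩
      · obtain ⟨π', h3, h4, h5⟩ := ih (π.snoc (f π.last) _ h1)
          ⟨hπ.1.snoc_ofFun (if_neg hle).symm h1, hπ.2.1, h2⟩ rfl
        exact ⟨π', h3, le_trans (Nat.le_add_left _ _) h4, h5⟩
  -- Each return to `s₀` followed by the rewarding step gains at least 1, unless reward `n` is
  -- reached on the way.
  have hgood : ∀ k, ∃ π, Good π ∧ (n ≤ π.rew ∨ k ≤ π.rew) := by
    intro k
    induction k with
    | zero => exact ⟨FinPath.nil M.init, ⟨Scheduler.IsSchedPath.nil _, rfl, h.reach⟩,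
        Or.inr (Nat.zero_le _)⟩
    | succ k ih =>
      obtain ⟨π, hπ, hk⟩ := ih
      by_cases hle : n ≤ π.rew
      · exact ⟨π, hπ, Or.inl hle⟩
      · have hk := hk.resolve_left hle
        obtain ⟨π', h3, h4, h5⟩ := hwalk _ hπ.2.2 π hπ rfl
        by_cases hle' : n ≤ π'.rew
        · exact ⟨π', h3, Or.inl hle'⟩
        · have hlast := h5.resolve_left hle'
          have hstep : 0 < M.P π'.last (f π'.last) t₀ := by rw [hlast]; exact h.step
          refine ⟨π'.snoc _ t₀ hstep, ⟨h3.1.snoc_ofFun (if_neg hle').symm hstep, h3.2.1, h.back⟩,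
            Or.inr ?_⟩
          have := h.rew_pos
          rw [FinPath.rew_snoc, hlast]
          omega
  have hgoalpath : ∃ π, 𝔖.IsSchedPath π ∧ π.first = M.init ∧ π.last = goal := by
    obtain ⟨π, ⟨h1, h2, h3⟩, h4⟩ := hgood n
    have h4 : n ≤ π.rew := h4.elim id id
    have hne : π.last ≠ fail := by
      intro hf
      have htrap := isTrap_fail hA1 hA2
      rcases Relation.ReflTransGen.cases_head h3 with h5 | ⟨v, hv, -⟩
      · rw [← h5, hf] at hs₀
        exact hs₀ htrap
      · rw [hf] at hv
        exact not_isTrap_of_mem_act (mem_act_of_pos hv) htrap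
    have hcan : M.CanReach π.last goal := by
      by_contra hcon
      exact hne ((hA1 _).mp hcon)
    have key : ∀ u, Relation.ReflTransGen (M.PolicyStep g) u goal → ∀ π, 𝔖.IsSchedPath π →
        π.first = M.init → n ≤ π.rew → π.last = u →
        ∃ π, 𝔖.IsSchedPath π ∧ π.first = M.init ∧ π.last = goal := by
      intro u hu
      induction hu using Relation.ReflTransGen.head_induction_on with
      | refl => exact fun π h1 h2 _ h4 => ⟨π, h1, h2, h4⟩
      | head h5 _ ih =>
        rintro π h1 h2 h4 rfl
        exact ih (π.snoc (g π.last) _ h5) (h1.snoc_ofFun (if_pos h4).symm h5) h2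
          (h4.trans (Nat.le_add_left _ _)) rfl
    exact key _ (hreach _ (canReach_iff.mp hcan)) π h1 h2 h4 rfl
  have hpos : 0 < 𝔖.Pr M.init (M.eventually {goal}) := by
    obtain ⟨π, h1, h2, h3⟩ := hgoalpath
    rw [← h2]
    exact h1.pr_eventually_pos 𝔖 h3
  -- Before the switch the path stays in `T`, which excludes `goal`; hence `goal` is visited only
  -- with reward at least `n`.
  have hinv := 𝔖.ae_invariant (s := M.init) (Q := fun π => n ≤ π.rew ∨ π.last ∈ T)
    (Or.inr h.init_mem) (fun π a t hp hn ha hπ => by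
      rw [Scheduler.ofFun_dist_pos] at ha
      by_cases hle : n ≤ π.rew
      · exact Or.inl (hle.trans (Nat.le_add_left _ _))
      · have ha : a = f π.last := ha.trans (if_neg hle)
        subst ha
        exact Or.inr (h.closed _ (hπ.resolve_left hle) t hp))
  refine ⟨𝔖, ⟨hpos, pr_eventually_goal_fail 𝔖 hA1 hA2 _⟩, ?_⟩
  have := cond_isProbabilityMeasure hpos.ne'
  have hae : ∀ᵐ ω ∂(ProbabilityTheory.cond (𝔖.Pr M.init) (M.eventually {goal})),
      (n : ℝ≥0∞) ≤ M.accReward {goal} ω := by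
    filter_upwards [cond_absolutelyContinuous.ae_le hinv] with ω hω
    rw [accReward]
    split_ifs with hex
    · have hspec := Nat.find_spec hex
      rcases hω (Nat.find hex) with h1 | h1
      · exact_mod_cast h1
      · rw [Set.mem_singleton_iff.mp hspec] at h1
        exact absurd h1 h.goal_notMem
    · exact le_top
  calc (n : ℝ≥0∞) = ∫⁻ _, (n : ℝ≥0∞) ∂(ProbabilityTheory.cond (𝔖.Pr M.init)
        (M.eventually {goal})) := by rw [lintegral_const, measure_univ, mul_one]
    _ ≤ 𝔖.CExp goal := lintegral_mono_ae hae

namespace Scheduler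

/-- The actions that are scheduled in `u` with positive probability on some path from the initial
state. -/
def usedActions (𝔖 : M.Scheduler) (u : S) : Set A :=
  {a | ∃ (π : M.FinPath) (hn : ¬ M.IsTrap π.last), 𝔖.IsSchedPath π ∧ π.first = M.init ∧
    π.last = u ∧ 0 < 𝔖.dist π hn a}

theorem IsSchedPath.of_snoc {𝔖 : M.Scheduler} {π : M.FinPath} {a : A} {t : S}
    {h : 0 < M.P π.last a t} (hs : 𝔖.IsSchedPath (π.snoc a t h)) :
    𝔖.IsSchedPath π ∧ ∃ hn, 0 < 𝔖.dist π hn a := by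
  generalize hρ : π.snoc a t h = ρ at hs
  cases hs with
  | nil s => exact absurd (congrArg FinPath.steps hρ) (List.cons_ne_nil _ _)
  | snoc π' a' t' h' hn' hs' ha' =>
    obtain ⟨s, l, hl⟩ := π
    obtain ⟨s', l', hl'⟩ := π'
    obtain rfl : s = s' := congrArg FinPath.first hρ
    have hsteps : (a, t) :: l = (a', t') :: l' := congrArg FinPath.steps hρ
    obtain ⟨⟨rfl, rfl⟩, rfl⟩ := by simpa only [List.cons.injEq, Prod.mk.injEq] using hsteps
    exact ⟨hs', hn', ha'⟩

/-- For each pair on `ξ` this records a way into it from the start of `ξ` and a way out to the end.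
When `ξ` is a cycle, these close up to a cycle of used actions through a chosen rewarding pair. -/
theorem IsSchedPath.append_steps {𝔖 : M.Scheduler} {π ξ : M.FinPath} {h : ξ.first = π.last}
    (hs : 𝔖.IsSchedPath (π.append ξ h)) (hinit : π.first = M.init) :
    𝔖.IsSchedPath π ∧ Relation.ReflTransGen (M.Step 𝔖.usedActions) ξ.first ξ.last ∧
    ∀ p ∈ ξ.pairs, p.2 ∈ 𝔖.usedActions p.1 ∧
      Relation.ReflTransGen (M.Step 𝔖.usedActions) ξ.first p.1 ∧
      ∃ t, 0 < M.P p.1 p.2 t ∧ Relation.ReflTransGen (M.Step 𝔖.usedActions) t ξ.last := by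
  induction ξ using FinPath.snocInduction with
  | nil s => exact ⟨hs, Relation.ReflTransGen.refl, by simp⟩
  | snoc ξ a t hp ih =>
    have h' : ξ.first = π.last := h
    have hlast : (π.append ξ h').last = ξ.last := FinPath.last_append π ξ h'
    have hp' : 0 < M.P (π.append ξ h').last a t := by rw [hlast]; exact hp
    have hs' : 𝔖.IsSchedPath ((π.append ξ h').snoc a t hp') := hs
    obtain ⟨h1, hn, ha⟩ := hs'.of_snoc
    obtain ⟨h2, h3, h4⟩ := ih (h := h') h1
    have hused : a ∈ 𝔖.usedActions ξ.last := ⟨_, hn, h1, hinit, hlast, ha⟩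
    refine ⟨h2, h3.tail ⟨a, hused, hp⟩, fun p hpm => ?_⟩
    rcases List.mem_cons.mp hpm with rfl | hpm
    · exact ⟨hused, h3, t, hp, Relation.ReflTransGen.refl⟩
    · obtain ⟨h5, h6, v, h7, h8⟩ := h4 p hpm
      exact ⟨h5, h6, v, h7, h8.tail ⟨a, hused, hp⟩⟩

/-- Every critical scheduler contains a positive loop. -/
theorem IsCritical.exists_isPositiveLoop {𝔘 : M.Scheduler} {goal : S} (h : 𝔘.IsCritical goal) :
    ∃ f T s t, M.IsPositiveLoop goal f T s t := by
  obtain ⟨hpr, π, ξ, hξ, hinit, ⟨-, hcyc⟩, ⟨p, hp, hrew⟩, hs⟩ := h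
  obtain ⟨hπ, -, hpairs⟩ := hs.append_steps hinit
  obtain ⟨h1, h2, t, h3, h4⟩ := hpairs p hp
  have hreach : Relation.ReflTransGen (M.Step 𝔘.usedActions) M.init π.last := by
    -- Here `π` is read as the continuation of the empty path.
    have := (IsSchedPath.append_steps (𝔖 := 𝔘) (π := FinPath.nil M.init) (ξ := π) (h := hinit)
      (by simpa [FinPath.append, FinPath.nil, ← hinit] using hπ) rfl).2.1
    rwa [hinit] at this
  let T : Set S := {u | ∃ π : M.FinPath, 𝔘.IsSchedPath π ∧ π.first = M.init ∧ π.last = u}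
  have hact : ∀ u ∈ T, ¬ M.IsTrap u → (𝔘.usedActions u ∩ M.act u).Nonempty := by
    rintro u ⟨ρ, h5, h6, rfl⟩ hn
    obtain ⟨a, ha⟩ := (𝔘.dist ρ hn).support_nonempty
    exact ⟨a, ⟨ρ, hn, h5, h6, rfl, pos_iff_ne_zero.mpr ((PMF.mem_support_iff _ _).mp ha)⟩,
      𝔘.support_subset ρ hn ha⟩
  -- The history that witnesses the use of `a` in `u` can be extended by `v`, whichever history
  -- witnesses `u ∈ T`. This is why memory can be dropped.
  have hclosed : ∀ u ∈ T, ∀ a ∈ 𝔘.usedActions u, ∀ v, 0 < M.P u a v → v ∈ T := by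
    rintro u - a ⟨ρ, hn, h5, h6, rfl, ha⟩ v hv
    exact ⟨ρ.snoc a v hv, IsSchedPath.snoc ρ a v hv hn h5 ha, h6, rfl⟩
  have hgoal : goal ∉ T := by
    rintro ⟨ρ, h5, h6, h7⟩
    have hpos := h5.pr_eventually_pos 𝔘 (F := {goal}) h7
    rw [h6] at hpos
    have hms : MeasurableSet {ω : ℕ → M.FinPath | ∀ n, (ω n).last ≠ goal} := by
      rw [Set.ofPred_forall]
      exact MeasurableSet.iInter fun n => measurableSet_history (fun π => π.last ≠ goal) n
    have hsub : M.eventually {goal} ⊆ {ω : ℕ → M.FinPath | ∀ n, (ω n).last ≠ goal}ᶜ := by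
      rintro ω ⟨n, hn⟩ hall
      exact hall n hn
    exact hpos.ne' (measure_mono_null hsub ((prob_compl_eq_zero_iff hms).mpr hpr))
  obtain ⟨f, hf⟩ := MDP.exists_isPositiveLoop T 𝔘.usedActions hact hclosed
    ⟨FinPath.nil _, IsSchedPath.nil _, rfl, rfl⟩ hgoal (hreach.trans (hξ ▸ h2)) h1 h3
    ((hcyc ▸ h4).trans h2) hrew
  exact ⟨f, T, _, _, hf⟩

end Scheduler

end MDP

end

/-! ### Bounded conditional expectations in the absence of positive loops -/

noncomputable section

namespace MDP

variable {S A : Type*} [Fintype S] [Fintype A] {M : MDP S A}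

theorem exists_forall_le_mul {ι : Type*} [Fintype ι] (x y : ι → ℝ≥0∞) (hx : ∀ i, x i ≠ ∞)
    (hy : ∀ i, y i ≠ ∞) : ∃ L : ℝ≥0∞, L ≠ ∞ ∧ ∀ i, y i ≠ 0 → x i ≤ L * y i := by
  classical
  refine ⟨∑ i, if y i = 0 then 0 else x i / y i, ?_, fun i hi => ?_⟩
  · refine ENNReal.sum_ne_top.mpr fun i _ => ?_
    split_ifs with h
    · exact ENNReal.zero_ne_top
    · exact ENNReal.div_ne_top (hx i) h
  · calc x i = x i / y i * y i := (ENNReal.div_mul_cancel hi (hy i)).symm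
      _ ≤ _ := by
        gcongr
        have := Finset.single_le_sum (f := fun i => if y i = 0 then 0 else x i / y i)
          (fun _ _ => zero_le) (Finset.mem_univ i)
        simpa only [if_neg hi] using this

theorem prob_ne_top (s : S) (a : A) (t : S) : M.prob s a t ≠ ∞ := ENNReal.coe_ne_top

theorem exists_rew_le (M : MDP S A) : ∃ R : ℕ, ∀ s a, M.rew s a ≤ R :=
  ⟨Finset.univ.sup fun p : S × A => M.rew p.1 p.2, fun s a =>
    Finset.le_sup (f := fun p : S × A => M.rew p.1 p.2) (Finset.mem_univ (s, a))⟩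

/-- The actions of `u` whose successors all belong to `W`. -/
def safeActions (M : MDP S A) (W : Set S) (u : S) : Set A :=
  {a | a ∈ M.act u ∧ ∀ t, 0 < M.P u a t → t ∈ W}

/-- The paths in the sub-MDP given by `W` and its safe actions. -/
def IsSafe (W : Set S) (π : M.FinPath) : Prop :=
  π.first ∈ W ∧ ∀ p ∈ π.pairs, p.2 ∈ M.safeActions W p.1

theorem isSafe_snoc {W : Set S} {π : M.FinPath} {a : A} {t : S} {h : 0 < M.P π.last a t} :
    IsSafe W (π.snoc a t h) ↔ IsSafe W π ∧ a ∈ M.safeActions W π.last := by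
  simp only [IsSafe, FinPath.first_snoc, FinPath.pairs_snoc, List.forall_mem_cons]
  tauto

theorem IsSafe.last_mem {W : Set S} {π : M.FinPath} (h : IsSafe W π) : π.last ∈ W := by
  induction π using FinPath.snocInduction with
  | nil s => exact h.1
  | snoc π a t hp _ => exact (isSafe_snoc.mp h).2.2 t hp

theorem IsSafe.reach {W : Set S} {π : M.FinPath} (h : IsSafe W π) :
    Relation.ReflTransGen (M.Step (M.safeActions W)) π.first π.last := by
  induction π using FinPath.snocInduction with
  | nil s => exact Relation.ReflTransGen.refl
  | snoc π a t hp ih =>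
    rw [isSafe_snoc] at h
    exact (ih h.1).tail ⟨a, h.2, hp⟩

/-- Without positive cycles, the rewards of safe paths are bounded. -/
theorem IsSafe.rew_le {W : Set S} {R : ℕ} (hR : ∀ s a, M.rew s a ≤ R)
    (hcyc : ∀ s t a, Relation.ReflTransGen (M.Step (M.safeActions W)) M.init s →
      a ∈ M.safeActions W s → 0 < M.P s a t →
      Relation.ReflTransGen (M.Step (M.safeActions W)) t s → M.rew s a = 0)
    {π : M.FinPath} (h : IsSafe W π) (hinit : π.first = M.init) :
    π.rew ≤ R * Fintype.card S := by
  -- Counting the safely reachable states gives a budget: a step inside a strongly connected piece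
  -- earns nothing, and a step with no way back earns at most `R` but lowers `ρ`.
  let ρ : S → ℕ := fun u => {x | Relation.ReflTransGen (M.Step (M.safeActions W)) u x}.ncard
  have key : π.rew + R * ρ π.last ≤ R * Fintype.card S := by
    induction π using FinPath.snocInduction with
    | nil s =>
      rw [FinPath.rew_nil, zero_add, ← Nat.card_eq_fintype_card]
      exact Nat.mul_le_mul_left _ (Set.ncard_le_card _)
    | snoc π a t hp ih =>
      rw [isSafe_snoc] at h
      refine le_trans ?_ (ih h.1 hinit)
      rw [FinPath.rew_snoc, FinPath.last_snoc]
      have hsub : {x | Relation.ReflTransGen (M.Step (M.safeActions W)) t x} ⊆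
          {x | Relation.ReflTransGen (M.Step (M.safeActions W)) π.last x} :=
        fun x hx => Relation.ReflTransGen.head ⟨a, h.2, hp⟩ hx
      by_cases hback : Relation.ReflTransGen (M.Step (M.safeActions W)) t π.last
      · have hreach := h.1.reach
        rw [show π.first = M.init from hinit] at hreach
        have h0 := hcyc _ t a hreach h.2 hp hback
        have := Nat.mul_le_mul_left R (Set.ncard_le_ncard hsub)
        change R * ρ t ≤ R * ρ π.last at this
        omega
      · have hlt : ρ t < ρ π.last := Set.ncard_lt_ncard
          ⟨hsub, fun hss => hback (hss (Relation.ReflTransGen.refl))⟩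
        have h1 := Nat.mul_le_mul_left R (Nat.succ_le_of_lt hlt)
        rw [Nat.mul_succ] at h1
        have := hR π.last a
        omega
  omega

namespace Scheduler

variable (𝔖 : M.Scheduler)

theorem expect_eq_sum (f : M.FinPath → ℝ≥0∞) {π : M.FinPath} (h : ¬ M.IsTrap π.last) :
    𝔖.expect f π = ∑ a, 𝔖.dist π h a * ∑ t, M.prob π.last a t *
      (open Classical in if ht : 0 < M.P π.last a t then f (π.snoc a t ht) else 0) := by
  rw [𝔖.expect_eq_sum_transition f h, ← 𝔖.sum_transition_eq h]
  refine Finset.sum_congr rfl fun p _ => ?_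
  rw [dif_pos p.2]

theorem expect_const_mul (c : ℝ≥0∞) (f : M.FinPath → ℝ≥0∞) (π : M.FinPath) :
    𝔖.expect (fun π => c * f π) π = c * 𝔖.expect f π :=
  lintegral_const_mul c Measurable.of_discrete

end Scheduler

open Classical in
/-- If `v` bounds the expected future reward, `w` is a lower bound for the probability of reaching
the goal, rewards of safe paths are bounded by `B`, and `L` is large enough, then the expected
reward of the unsafe paths is at most `L` times their probability of reaching the goal. -/
theorem iterate_expect_le_mul_of_isSafe (𝔖 : M.Scheduler) {W : Set S} {v w : S → ℝ≥0∞} {B L : ℝ≥0∞}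
    (hv : ∀ s, ∀ a ∈ M.act s, M.rew s a + ∑ t, M.prob s a t * v t ≤ v s)
    (hw : ∀ s, ∀ a ∈ M.act s, w s ≤ ∑ t, M.prob s a t * w t)
    (hB : ∀ π : M.FinPath, π.first = M.init → IsSafe W π → (π.rew : ℝ≥0∞) ≤ B)
    (hL : ∀ s a t, 0 < M.P s a t → t ∉ W → B + v s ≤ L * (M.prob s a t * w t)) (n : ℕ) :
    ∀ π : M.FinPath, π.first = M.init →
      (¬ IsSafe W π →
        𝔖.expect^[n] (fun π => if IsSafe W π then 0 else π.rew + v π.last) π ≤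
          π.rew + v π.last ∧
        w π.last ≤ 𝔖.expect^[n] (fun π => if IsSafe W π then 0 else w π.last) π) ∧
      (IsSafe W π →
        𝔖.expect^[n] (fun π => if IsSafe W π then 0 else π.rew + v π.last) π ≤
          L * 𝔖.expect^[n] (fun π => if IsSafe W π then 0 else w π.last) π) := by
  set F : M.FinPath → ℝ≥0∞ := fun π => if IsSafe W π then 0 else π.rew + v π.last with hF
  set G : M.FinPath → ℝ≥0∞ := fun π => if IsSafe W π then 0 else w π.last with hG
  have hsum : ∀ (π : M.FinPath), ∀ a ∈ M.act π.last,
      ∑ t, M.prob π.last a t * (((M.rew π.last a + π.rew : ℕ) : ℝ≥0∞) + v t) ≤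
        π.rew + v π.last := by
    intro π a ha
    simp only [mul_add, Finset.sum_add_distrib, ← Finset.sum_mul, sum_prob ha, one_mul]
    calc ((M.rew π.last a + π.rew : ℕ) : ℝ≥0∞) + ∑ t, M.prob π.last a t * v t
        = π.rew + (M.rew π.last a + ∑ t, M.prob π.last a t * v t) := by push_cast; ring
      _ ≤ _ := by gcongr; exact hv _ a ha
  induction n with
  | zero =>
    refine fun π _ => ⟨fun h => ?_, fun h => ?_⟩
    · simp [hF, hG, h]
    · simp [hF, h]
  | succ n ih =>
    intro π hπ
    by_cases ht : M.IsTrap π.last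
    · rw [𝔖.iterate_expect_trap _ ht, 𝔖.iterate_expect_trap _ ht]
      refine ⟨fun h => ?_, fun h => ?_⟩
      · simp [hF, hG, h]
      · simp [hF, h]
    rw [Function.iterate_succ_apply', Function.iterate_succ_apply']
    refine ⟨fun h => ⟨?_, ?_⟩, fun h => ?_⟩
    · exact 𝔖.expect_le ht (fun a t => ((M.rew π.last a + π.rew : ℕ) : ℝ≥0∞) + v t)
        (fun a t hp _ => ((ih (π.snoc a t hp) hπ).1 fun hs => h (isSafe_snoc.mp hs).1).1)
        fun a ha _ => hsum π a ha
    · exact 𝔖.le_expect ht (fun _ t => w t)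
        (fun a t hp _ => ((ih (π.snoc a t hp) hπ).1 fun hs => h (isSafe_snoc.mp hs).1).2)
        fun a ha _ => hw _ a ha
    · rw [← 𝔖.expect_const_mul, 𝔖.expect_eq_sum _ ht, 𝔖.expect_eq_sum _ ht]
      refine Finset.sum_le_sum fun a _ => ?_
      rcases eq_or_ne (𝔖.dist π ht a) 0 with h0 | h0
      · simp [h0]
      have ha := 𝔖.mem_act_of_dist_pos (pos_iff_ne_zero.mpr h0)
      refine mul_le_mul' le_rfl ?_
      by_cases hsafe : a ∈ M.safeActions W π.last
      · refine Finset.sum_le_sum fun t _ => ?_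
        gcongr
        split_ifs with hp
        · exact (ih (π.snoc a t hp) hπ).2 (isSafe_snoc.mpr ⟨h, hsafe⟩)
        · exact le_rfl
      -- Leaving the safe regime: all successor histories count as unsafe from now on, even those
      -- ending in `W`. The single successor `t` outside `W` supplies enough goal probability to pay
      -- for `B + v π.last`.
      · obtain ⟨t, hp, htW⟩ : ∃ t, 0 < M.P π.last a t ∧ t ∉ W := by
          by_contra! hc
          exact hsafe ⟨ha, hc⟩
        have hns : ∀ u (hu : 0 < M.P π.last a u), ¬ IsSafe W (π.snoc a u hu) :=
          fun u hu hs => hsafe (isSafe_snoc.mp hs).2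
        calc _ ≤ ∑ u, M.prob π.last a u * (((M.rew π.last a + π.rew : ℕ) : ℝ≥0∞) + v u) := by
              refine Finset.sum_le_sum fun u _ => ?_
              gcongr
              split_ifs with hu
              · exact ((ih (π.snoc a u hu) hπ).1 (hns u hu)).1
              · exact zero_le
          _ ≤ π.rew + v π.last := hsum π a ha
          _ ≤ B + v π.last := by gcongr; exact hB π hπ h
          _ ≤ L * (M.prob π.last a t * w t) := hL _ a t hp htW
          _ = M.prob π.last a t * (L * w t) := mul_left_comm _ _ _
          _ ≤ M.prob π.last a t * (if hu : 0 < M.P π.last a t then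
                L * 𝔖.expect^[n] G (π.snoc a t hu) else 0) := by
              rw [dif_pos hp]
              gcongr
              exact ((ih (π.snoc a t hp) hπ).1 (hns t hp)).2
          _ ≤ _ := Finset.single_le_sum (f := fun u => M.prob π.last a u *
                (if hu : 0 < M.P π.last a u then
                  L * 𝔖.expect^[n] G (π.snoc a u hu) else 0))
                (fun _ _ => zero_le) (Finset.mem_univ t)

open Filter Topology in
/-- A bound for the expected reward of the histories that end in `goal` carries over to the
conditional expectation. -/
theorem CExp_le_of_forall_le (𝔖 : M.Scheduler) {goal : S} (hgoal : M.IsTrap goal)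
    (hA2 : M.NoEndComponent) {L : ℝ≥0∞} (hL : L ≠ ∞)
    (h : ∀ n, ∫⁻ ω, (open Classical in if (ω n).last = goal then ((ω n).rew : ℝ≥0∞) else 0)
      ∂𝔖.Pr M.init ≤
        L * (𝔖.Pr M.init (M.eventually {goal}) + ∫⁻ ω, notTrap (ω n) ∂𝔖.Pr M.init)) :
    𝔖.CExp goal ≤ L := by
  classical
  let g : M.FinPath → ℝ≥0∞ := fun π => if π.last = goal then (π.rew : ℝ≥0∞) else 0
  -- As `goal` is a trap, the history is frozen once it is hit, so `g (ω n)` is eventually the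
  -- accumulated reward and Fatou's lemma applies.
  have hae : ∀ᵐ ω ∂(𝔖.Pr M.init).restrict (M.eventually {goal}),
      M.accReward {goal} ω ≤ liminf (fun n => g (ω n)) atTop := by
    filter_upwards [ae_restrict_mem (measurableSet_eventually _),
      ae_restrict_of_ae (𝔖.ae_trap_stays M.init)] with ω hex hstay
    have hex' : ∃ n, (ω n).last ∈ ({goal} : Set S) := hex
    have hspec : (ω (Nat.find hex')).last = goal := Nat.find_spec hex'
    have hconst : ∀ k, ω (Nat.find hex' + k) = ω (Nat.find hex') := by
      intro k
      induction k with
      | zero => rfl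
      | succ k ih =>
        rw [← add_assoc, hstay _ (by rw [ih, hspec]; exact hgoal), ih]
    rw [accReward, dif_pos hex']
    refine le_liminf_of_le (by isBoundedDefault) ?_
    filter_upwards [eventually_ge_atTop (Nat.find hex')] with m hm
    obtain ⟨k, rfl⟩ := Nat.exists_eq_add_of_le hm
    rw [hconst k]
    simp only [g, if_pos hspec]
    convert le_rfl
  have hlim : Tendsto (fun n => L * (𝔖.Pr M.init (M.eventually {goal}) +
      ∫⁻ ω, notTrap (ω n) ∂𝔖.Pr M.init)) atTop
      (𝓝 (L * (𝔖.Pr M.init (M.eventually {goal}) + 0))) :=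
    ENNReal.Tendsto.const_mul ((hA2.tendsto_notTrap 𝔖 M.init).const_add _) (Or.inr hL)
  have hint : ∫⁻ ω in M.eventually {goal}, M.accReward {goal} ω ∂𝔖.Pr M.init ≤
      L * 𝔖.Pr M.init (M.eventually {goal}) := by
    calc _ ≤ ∫⁻ ω in M.eventually {goal}, liminf (fun n => g (ω n)) atTop ∂𝔖.Pr M.init :=
          lintegral_mono_ae hae
      _ ≤ ∫⁻ ω, liminf (fun n => g (ω n)) atTop ∂𝔖.Pr M.init := setLIntegral_le_lintegral _ _
      _ ≤ liminf (fun n => ∫⁻ ω, g (ω n) ∂𝔖.Pr M.init) atTop :=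
          lintegral_liminf_le fun n => measurable_comp_history g n
      _ ≤ liminf (fun n => L * (𝔖.Pr M.init (M.eventually {goal}) +
            ∫⁻ ω, notTrap (ω n) ∂𝔖.Pr M.init)) atTop :=
          liminf_le_liminf (Eventually.of_forall h)
      _ = L * 𝔖.Pr M.init (M.eventually {goal}) := by rw [hlim.liminf_eq, add_zero]
  rw [Scheduler.CExp, ProbabilityTheory.cond, lintegral_smul_measure, smul_eq_mul]
  -- If `goal` has probability 0, the product of inverse and measure is `∞ * 0 = 0`, so the bound
  -- holds for every scheduler.
  calc _ ≤ (𝔖.Pr M.init (M.eventually {goal}))⁻¹ *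
        (L * 𝔖.Pr M.init (M.eventually {goal})) := by gcongr
    _ = L * ((𝔖.Pr M.init (M.eventually {goal}))⁻¹ * 𝔖.Pr M.init (M.eventually {goal})) :=
        mul_left_comm _ _ _
    _ ≤ L * 1 := by gcongr; exact ENNReal.inv_mul_le_one _
    _ = L := mul_one L

/-- Without positive loops, the conditional expectations are bounded. -/
theorem exists_CExp_le {goal : S} (hgoal : M.IsTrap goal) (hA2 : M.NoEndComponent)
    (hno : ∀ f T s t, ¬ M.IsPositiveLoop goal f T s t) :
    ∃ L : ℝ≥0∞, L ≠ ∞ ∧ ∀ 𝔖 : M.Scheduler, 𝔖.CExp goal ≤ L := by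
  classical
  obtain ⟨W, w, hgW, hwpos, hw1, hwtrap, hw, hW⟩ := M.exists_goalBound goal hgoal
  obtain ⟨v₁, hv₁, hv₁'⟩ := hA2.exists_stepBound
  obtain ⟨R, hR⟩ := M.exists_rew_le
  let v : S → ℝ≥0∞ := fun s => R * v₁ s
  have hvtop : ∀ s, v s ≠ ∞ := fun s => ENNReal.mul_ne_top (ENNReal.natCast_ne_top R) (hv₁ s)
  have hv : ∀ s, ∀ a ∈ M.act s, M.rew s a + ∑ t, M.prob s a t * v t ≤ v s := by
    intro s a ha
    calc (M.rew s a : ℝ≥0∞) + ∑ t, M.prob s a t * v t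
        ≤ R + ∑ t, M.prob s a t * v t := by gcongr; exact hR s a
      _ = R * (1 + ∑ t, M.prob s a t * v₁ t) := by
          rw [mul_add, mul_one, Finset.mul_sum]
          congr 1
          exact Finset.sum_congr rfl fun t _ => mul_left_comm _ _ _
      _ ≤ v s := mul_le_mul' le_rfl (hv₁' s a ha)
  let B : ℝ≥0∞ := ((R * Fintype.card S : ℕ) : ℝ≥0∞)
  have hB : ∀ π : M.FinPath, π.first = M.init → IsSafe W π → (π.rew : ℝ≥0∞) ≤ B := by
    intro π hπ hs
    refine Nat.cast_le.mpr (hs.rew_le hR (fun s t a h1 h2 h3 h4 => ?_) hπ)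
    by_contra h0
    -- A rewarding cycle of safe actions would be a positive loop with `T = W`.
    obtain ⟨f, hf⟩ := exists_isPositiveLoop (goal := goal) W (M.safeActions W)
      (fun u hu hn => by
        obtain ⟨b, hb, hb'⟩ := hW u hu hn
        exact ⟨b, ⟨hb, hb'⟩, hb⟩)
      (fun u _ b hb x hx => hb.2 x hx) (hπ ▸ hs.1) hgW h1 h2 h3 h4 (Nat.pos_of_ne_zero h0)
    exact hno _ _ _ _ hf
  have hwtop : ∀ s, w s ≠ ∞ := fun s => ne_top_of_le_ne_top ENNReal.one_ne_top (hw1 s)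
  obtain ⟨L₁, hL₁, hL₁'⟩ := exists_forall_le_mul (fun p : S × A × S => B + v p.1)
    (fun p => M.prob p.1 p.2.1 p.2.2 * w p.2.2)
    (fun p => ENNReal.add_ne_top.mpr ⟨ENNReal.natCast_ne_top _, hvtop _⟩)
    (fun p => ENNReal.mul_ne_top (prob_ne_top _ _ _) (hwtop _))
  obtain ⟨L₂, hL₂, hL₂'⟩ := exists_forall_le_mul v w hvtop hwtop
  -- `L₁` pays for leaving the safe regime, `L₂` for starting outside `W`.
  let L := L₁ + L₂
  have hL : L ≠ ∞ := ENNReal.add_ne_top.mpr ⟨hL₁, hL₂⟩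
  refine ⟨L, hL, fun 𝔖 => CExp_le_of_forall_le 𝔖 hgoal hA2 hL fun n => ?_⟩
  let F : M.FinPath → ℝ≥0∞ := fun π => if IsSafe W π then 0 else π.rew + v π.last
  let G : M.FinPath → ℝ≥0∞ := fun π => if IsSafe W π then 0 else w π.last
  have hFG : ∫⁻ ω, F (ω n) ∂𝔖.Pr M.init ≤ L * ∫⁻ ω, G (ω n) ∂𝔖.Pr M.init := by
    rw [𝔖.lintegral_history, 𝔖.lintegral_history]
    have key := iterate_expect_le_mul_of_isSafe 𝔖 (L := L) hv hw hB (fun s a t hp ht =>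
      (hL₁' (s, a, t) (mul_ne_zero (prob_pos.mpr hp).ne' (hwpos t ht).ne')).trans
        (by gcongr; exact le_self_add)) n (FinPath.nil M.init) rfl
    by_cases hinit : M.init ∈ W
    · exact key.2 ⟨hinit, by simp⟩
    · obtain ⟨h1, h2⟩ := key.1 fun hs => hinit hs.1
      refine h1.trans ?_
      rw [FinPath.rew_nil, Nat.cast_zero, zero_add]
      exact (hL₂' M.init (hwpos _ hinit).ne').trans (mul_le_mul' le_add_self h2)
  have hgF : ∫⁻ ω, (if (ω n).last = goal then ((ω n).rew : ℝ≥0∞) else 0) ∂𝔖.Pr M.init ≤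
      ∫⁻ ω, F (ω n) ∂𝔖.Pr M.init := by
    refine lintegral_mono fun ω => ?_
    by_cases hg : (ω n).last = goal
    · have hns : ¬ IsSafe W (ω n) := fun hs => hgW (hg ▸ hs.last_mem)
      simp only [F, if_pos hg, if_neg hns]
      exact le_self_add
    · simp [hg]
  -- `w` is at most 1 and vanishes at traps other than `goal`, so only `goal` and unfinished
  -- histories contribute.
  have hG : ∫⁻ ω, G (ω n) ∂𝔖.Pr M.init ≤
      𝔖.Pr M.init (M.eventually {goal}) + ∫⁻ ω, notTrap (ω n) ∂𝔖.Pr M.init := by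
    rw [← lintegral_indicator_one (measurableSet_eventually _),
      ← lintegral_add_right _ (measurable_comp_history notTrap n)]
    refine lintegral_mono fun ω => ?_
    have hGw : G (ω n) ≤ w (ω n).last := by
      simp only [G]
      split_ifs
      · exact zero_le
      · exact le_rfl
    refine hGw.trans ?_
    by_cases ht : M.IsTrap (ω n).last
    · by_cases hg : (ω n).last = goal
      · have : ω ∈ M.eventually {goal} := ⟨n, hg⟩
        rw [Set.indicator_of_mem this]
        exact (hw1 _).trans le_self_add
      · rw [hwtrap _ ht hg]
        exact zero_le
    · rw [notTrap, if_neg ht]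
      exact (hw1 _).trans le_add_self
  calc _ ≤ _ := hgF
    _ ≤ _ := hFG
    _ ≤ _ := by gcongr

end MDP

end

/-! ### The equivalence -/

theorem mainTheorem6 {S A : Type*} [Fintype S] [Fintype A] (M : MDP S A) (goal fail : S)
    (hgoal : M.IsTrap goal)
    (hA1 : ∀ s : S, ¬ M.CanReach s goal ↔ s = fail)
    (hA2 : M.NoEndComponent) :
    List.TFAE
      [M.CExpMax goal fail = ⊤,
        ∃ 𝔘 : M.Scheduler, 𝔘.IsMemoryless ∧ 𝔘.IsDeterministic ∧ 𝔘.IsCritical goal,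
        ∃ 𝔘 : M.Scheduler, 𝔘.IsCritical goal] := by
  tfae_have 1 → 2 := by
    intro h
    by_contra hc
    obtain ⟨L, hL, hle⟩ := MDP.exists_CExp_le hgoal hA2 fun f T s t hf =>
      hc hf.exists_critical
    have hmax : M.CExpMax goal fail ≤ (L : EReal) :=
      iSup₂_le fun 𝔖 _ => EReal.coe_ennreal_le_coe_ennreal_iff.mpr (hle 𝔖)
    rw [h, top_le_iff, EReal.coe_ennreal_eq_top_iff] at hmax
    exact hL hmax
  tfae_have 2 → 3 := fun ⟨𝔘, _, _, h⟩ => ⟨𝔘, h⟩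
  tfae_have 3 → 1 := by
    rintro ⟨𝔘, h⟩
    obtain ⟨f, T, s, t, hf⟩ := h.exists_isPositiveLoop
    rw [EReal.eq_top_iff_forall_lt]
    intro y
    obtain ⟨n, hn⟩ := exists_nat_gt y
    obtain ⟨𝔖, h1, h2⟩ := hf.exists_le_CExp hA1 hA2 n
    calc (y : EReal) < ((n : ℝ) : EReal) := EReal.coe_lt_coe_iff.mpr hn
      _ = ((n : ℝ≥0∞) : EReal) := by
        rw [← ENNReal.ofReal_natCast, EReal.coe_ennreal_ofReal, max_eq_left (Nat.cast_nonneg n)]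
      _ ≤ (𝔖.CExp goal : EReal) := EReal.coe_ennreal_le_coe_ennreal_iff.mpr h2
      _ ≤ M.CExpMax goal fail :=
        le_iSup₂ (f := fun (𝔖 : M.Scheduler) (_ : 𝔖.IsAdmissible goal fail) =>
          ((𝔖.CExp goal : ℝ≥0∞) : EReal)) 𝔖 h1
  tfae_finish
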